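/- Let $N$ qubits labeled $1,\dots,N$ form a chain and let $\sigma_l^x,\sigma_l^y,\sigma_l^z$ be the Pauli matrices of qubit $l$. Let $n$ be a positive integer, $0=t_0<t_1<\cdots<t_n=1$, $\alpha=(\alpha_j^u)\in\{0,1\}^{3n}$ and $\gamma=(\gamma_j^{u,v})\in\{0,1\}^{9n}$ ($1\le j\le n$; $u,v\in\{x,y,z\}$). For $\mathbf h=(h_{j,l}^u)\in\mathbb R^{3nN}$ and $\mathbf J=(J_{j,l}^{u,v})\in\mathbb R^{9n(N-1)}$ let $H(t)$ be the Hamiltonian with $H(t+1)=H(t)$ and $$H(t)=H_j:=\sum_{l=1}^N\sum_{u}\alpha_j^u h_{j,l}^u\sigma_l^u+\sum_{l=1}^{N-1}\sum_{u,v}\gamma_j^{u,v}J_{j,l}^{u,v}\sigma_l^u\sigma_{l+1}^v,\qquad t_{j-1}\le t<t_j .$$ Let $|\psi(0)\rangle=\bigotimes_{l=1}^N|\phi_l\rangle$ be a Haar-random product state, i.e., the $|\phi_l\rangle$ are independent and uniformly (Haar) distributed unit vectors of $\mathbb C^2$, and let $|\psi(t)\rangle=\mathcal Te^{-i\int_0^tH(s)\,\mathrm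 ds}|\psi(0)\rangle$, $t\ge0$, where $\mathcal T$ is time ordering. A function $f$ of time is called $\epsilon$-periodic (with period $1$) if there is a measurable function $\bar f:[0,1)\to\mathbb R$ such that $$\liminf_{M\to\infty}\frac1M\left|\left\{m\in\{0,\dots,M-1\}:\int_0^1|f(m+x)-\bar f(x)|^2\,\mathrm dx\le\epsilon\right\}\right|\ge1-\epsilon .$$ Theorem. There exist universal constants $c>0$ and $N_0$ such that the following holds for every $N>N_0$ and every tuple $(n,(t_j),\alpha,\gamma)$ with $\alpha_1^x=\alpha_1^z=\gamma_1^{zz}=1$. For all $(\mathbf h,\mathbf J)\in\mathbb R^{12nN-9n}$ outside a set of Lebesgue measure zero and for every Hermitian operator $A$ on the $N$ qubits with operator norm $\|A\|=1$, $$\Pr_{|\psi(0)\rangle}\big(\langle\psi(t)|A|\psi(t)\rangle\text{ is }e^{-cN}\text{-periodic}\big)\ge1-e^{-cN}.$$ -/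

import Mathlib

open MeasureTheory Filter Topology

/-! ## Qubit chains -/

/-- The three labels `x`, `y`, `z` of the Pauli matrices. -/
inductive Axis where
  | x
  | y
  | z
  deriving DecidableEq

instance Axis.fintype : Fintype Axis :=
  ⟨{Axis.x, Axis.y, Axis.z}, fun u => by cases u <;> decide⟩

/-- The Pauli matrices. -/
def pauli : Axis → Matrix (Fin 2) (Fin 2) ℂ
  | .x => !![0, 1; 1, 0]
  | .y => !![0, -Complex.I; Complex.I, 0]
  | .z => !![1, 0; 0, -1]

/-- The computational basis configurations of `N` qubits; the Hilbert space `(ℂ²)^{⊗N}` is the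
space of functions `Config N → ℂ`. -/
abbrev Config (N : ℕ) : Type := Fin N → Fin 2

/-- Operators on the Hilbert space of `N` qubits. -/
abbrev Operator (N : ℕ) : Type := Matrix (Config N) (Config N) ℂ

/-- The Pauli operator `σ_l^u` : the tensor product of `σ^u` on qubit `l` and of the identity on all
other qubits. -/
noncomputable def pauliAt {N : ℕ} (l : Fin N) (u : Axis) : Operator N :=
  fun s s' => ∏ k : Fin N, (if k = l then pauli u else 1) (s k) (s' k)

/-! ## Ensembles of piecewise time-independent Floquet systems -/

/-- `T = (t_0, …, t_n)` with `0 = t_0 < t_1 < ⋯ < t_n = 1`. -/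
def IsTimePartition {n : ℕ} (T : Fin (n + 1) → ℝ) : Prop :=
  T 0 = 0 ∧ StrictMono T ∧ T (Fin.last n) = 1

/-- The parameters `(h, J) ∈ ℝ^{3nN} × ℝ^{9n(N-1)}`. The coupling with site index `l : Fin (N - 1)`
acts on the qubits `l` and `l + 1`. -/
abbrev Params (n N : ℕ) : Type :=
  (Fin n × Fin N × Axis → ℝ) × (Fin n × Fin (N - 1) × Axis × Axis → ℝ)

/-- The left qubit of the `l`-th bond of the chain. -/
def bondLeft {N : ℕ} (l : Fin (N - 1)) : Fin N := ⟨l, by omega⟩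

/-- The right qubit of the `l`-th bond of the chain. -/
def bondRight {N : ℕ} (l : Fin (N - 1)) : Fin N := ⟨l + 1, by omega⟩

/-- The Hamiltonian `H_j` of the `j`-th piece. The entries of `α` and `γ` are `0` or `1`. -/
noncomputable def pieceHamiltonian {n N : ℕ} (α : Fin n → Axis → Fin 2)
    (γ : Fin n → Axis → Axis → Fin 2) (p : Params n N) (j : Fin n) : Operator N :=
  (∑ l : Fin N, ∑ u : Axis,
      ((((α j u : ℕ) : ℝ) * p.1 (j, l, u) : ℝ) : ℂ) • pauliAt l u) +
    ∑ l : Fin (N - 1), ∑ u : Axis, ∑ v : Axis,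
      ((((γ j u v : ℕ) : ℝ) * p.2 (j, l, u, v) : ℝ) : ℂ) •
        (pauliAt (bondLeft l) u * pauliAt (bondRight l) v)

/-- The piecewise constant, `1`-periodic Hamiltonian `t ↦ H(t)` with pieces `H_j`: it equals `H_j`
whenever `t_{j-1} ≤ t mod 1 < t_j`. -/
noncomputable def floquetHamiltonian {n N : ℕ} (T : Fin (n + 1) → ℝ) (H : Fin n → Operator N)
    (t : ℝ) : Operator N :=
  ∑ j : Fin n, if T j.castSucc ≤ Int.fract t ∧ Int.fract t < T j.succ then H j else 0

/-- `exp (-i τ H)`. -/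
noncomputable def evolveFor {N : ℕ} (τ : ℝ) (H : Operator N) : Operator N :=
  NormedSpace.exp (τ • (-Complex.I • H))

/-- The part of the time interval `[0, s]` that is spent in the `j`-th piece. -/
noncomputable def pieceTime {n : ℕ} (T : Fin (n + 1) → ℝ) (j : Fin n) (s : ℝ) : ℝ :=
  max 0 (min s (T j.succ) - T j.castSucc)

/-- The time-ordered exponential `U(0, s)` within the first period, `0 ≤ s ≤ 1`: the product of the
evolutions over the pieces, later pieces to the left. -/
noncomputable def periodEvolution {n N : ℕ} (T : Fin (n + 1) → ℝ) (H : Fin n → Operator N)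
    (s : ℝ) : Operator N :=
  ((List.ofFn fun j : Fin n => evolveFor (pieceTime T j s) (H j)).reverse).prod

/-- The time-evolution operator `U(0, t)` for `t ≥ 0` (values at `t < 0` play no role):
`U(0, m + s) = U(0, s) U_F ^ m` for `m ∈ ℕ`, `s ∈ [0, 1)`, where `U_F = U(0, 1)`. -/
noncomputable def evolution {n N : ℕ} (T : Fin (n + 1) → ℝ) (H : Fin n → Operator N)
    (t : ℝ) : Operator N :=
  periodEvolution T H (Int.fract t) * periodEvolution T H 1 ^ ⌊t⌋₊

/-! ### `evolution` solves the Schrödinger equation of `floquetHamiltonian` -/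

lemma prod_reverse_ofFn_of_step {M : Type*} [Monoid M] {n : ℕ} (f g : Fin n → M) (a : M)
    (j : Fin n) (hlt : ∀ i, i < j → g i = f i) (hj : g j = a * f j)
    (hgt : ∀ i, j < i → g i = 1 ∧ f i = 1) :
    (List.ofFn g).reverse.prod = a * (List.ofFn f).reverse.prod := by
  induction n with
  | zero => exact j.elim0
  | succ n ih =>
    rw [List.ofFn_succ, List.ofFn_succ, List.reverse_cons, List.reverse_cons, List.prod_append,
      List.prod_append, List.prod_singleton, List.prod_singleton]
    induction j using Fin.cases with
    | zero =>
      have h1 : (fun i : Fin n => g i.succ) = fun _ => 1 :=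
        funext fun i => (hgt i.succ (Fin.succ_pos i)).1
      have h2 : (fun i : Fin n => f i.succ) = fun _ => 1 :=
        funext fun i => (hgt i.succ (Fin.succ_pos i)).2
      rw [h1, h2, hj]
      simp
    | succ j =>
      rw [ih (fun i => f i.succ) (fun i => g i.succ) j
        (fun i hi => hlt _ (Fin.succ_lt_succ_iff.2 hi)) hj
        (fun i hi => hgt _ (Fin.succ_lt_succ_iff.2 hi)), hlt 0 (Fin.succ_pos j), mul_assoc]

lemma evolveFor_zero {N : ℕ} (H : Operator N) : evolveFor 0 H = 1 := by
  simp [evolveFor]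

lemma evolveFor_add {N : ℕ} (a b : ℝ) (H : Operator N) :
    evolveFor (a + b) H = evolveFor a H * evolveFor b H := by
  rw [evolveFor, add_smul, Matrix.exp_add_of_commute]
  · rfl
  · exact ((Commute.refl _).smul_left _).smul_right _

lemma periodEvolution_zero {n N : ℕ} {T : Fin (n + 1) → ℝ} (hT : IsTimePartition T)
    (H : Fin n → Operator N) : periodEvolution T H 0 = 1 := by
  have h : ∀ j : Fin n, evolveFor (pieceTime T j 0) (H j) = 1 := fun j => by
    have h0 : 0 ≤ T j.castSucc := hT.1 ▸ hT.2.1.monotone (Fin.zero_le _)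
    have h1 : pieceTime T j 0 = 0 := max_eq_left (by linarith [min_le_left 0 (T j.succ)])
    rw [h1, evolveFor_zero]
  rw [periodEvolution, funext h]
  simp

lemma periodEvolution_step {n N : ℕ} {T : Fin (n + 1) → ℝ} (hT : IsTimePartition T)
    (H : Fin n → Operator N) (j : Fin n) {s s' : ℝ} (h0 : T j.castSucc ≤ s) (hs : s ≤ s')
    (h1 : s' ≤ T j.succ) :
    periodEvolution T H s' = evolveFor (s' - s) (H j) * periodEvolution T H s := by
  refine prod_reverse_ofFn_of_step _ _ _ j (fun i hi => ?_) ?_ (fun i hi => ?_)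
  · have h : T i.succ ≤ T j.castSucc := hT.2.1.monotone (Fin.succ_le_castSucc_iff.2 hi)
    simp only [pieceTime]
    rw [min_eq_right (by linarith), min_eq_right (by linarith)]
  · simp only [pieceTime]
    rw [min_eq_left h1, min_eq_left (hs.trans h1), max_eq_right (by linarith),
      max_eq_right (by linarith), ← evolveFor_add]
    congr 1
    ring
  · have h : T j.succ ≤ T i.castSucc := hT.2.1.monotone (Fin.succ_le_castSucc_iff.2 hi)
    simp only [pieceTime]
    rw [max_eq_left, max_eq_left, evolveFor_zero]
    · exact ⟨rfl, rfl⟩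
    · linarith [min_le_left s (T i.succ)]
    · linarith [min_le_left s' (T i.succ)]

lemma evolution_nat_add {n N : ℕ} {T : Fin (n + 1) → ℝ} (hT : IsTimePartition T)
    (H : Fin n → Operator N) (m : ℕ) {s : ℝ} (h0 : 0 ≤ s) (h1 : s ≤ 1) :
    evolution T H (m + s) = periodEvolution T H s * periodEvolution T H 1 ^ m := by
  rcases h1.lt_or_eq with h | rfl
  · have hf : ⌊(m : ℝ) + s⌋₊ = m := by
      rw [Nat.floor_eq_iff (by positivity)]
      constructor <;> linarith
    rw [evolution, hf, Int.fract_natCast_add, Int.fract_eq_self.2 ⟨h0, h⟩]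
  · have hf : ⌊(m : ℝ) + 1⌋₊ = m + 1 := by exact_mod_cast Nat.floor_natCast (m + 1)
    have hr : Int.fract ((m : ℝ) + 1) = 0 := by exact_mod_cast Int.fract_natCast (m + 1)
    rw [evolution, hf, hr, periodEvolution_zero hT, one_mul, pow_succ']

/-- `U(0, 0) = 1`. -/
theorem evolution_zero {n N : ℕ} {T : Fin (n + 1) → ℝ} (hT : IsTimePartition T)
    (H : Fin n → Operator N) : evolution T H 0 = 1 := by
  simp [evolution, periodEvolution_zero hT]

lemma evolution_step {n N : ℕ} {T : Fin (n + 1) → ℝ} (hT : IsTimePartition T)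
    (H : Fin n → Operator N) (m : ℕ) (j : Fin n) {s s' : ℝ} (h0 : T j.castSucc ≤ s) (hs : s ≤ s')
    (h1 : s' ≤ T j.succ) :
    evolution T H (m + s') = evolveFor (s' - s) (H j) * evolution T H (m + s) := by
  have a0 : 0 ≤ T j.castSucc := hT.1 ▸ hT.2.1.monotone (Fin.zero_le _)
  have a1 : T j.succ ≤ 1 := hT.2.2 ▸ hT.2.1.monotone (Fin.le_last _)
  rw [evolution_nat_add hT H m (by linarith) (by linarith),
    evolution_nat_add hT H m (by linarith) (by linarith),
    periodEvolution_step hT H j h0 hs h1, mul_assoc]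

lemma floquetHamiltonian_eq {n N : ℕ} {T : Fin (n + 1) → ℝ} (hT : IsTimePartition T)
    (H : Fin n → Operator N) (j : Fin n) {t : ℝ} (h0 : T j.castSucc ≤ Int.fract t)
    (h1 : Int.fract t < T j.succ) : floquetHamiltonian T H t = H j := by
  rw [floquetHamiltonian, Finset.sum_eq_single j, if_pos ⟨h0, h1⟩]
  · rintro i - hij
    refine if_neg fun h => ?_
    rcases lt_or_gt_of_ne hij with hi | hi
    · have := hT.2.1.monotone (Fin.succ_le_castSucc_iff.2 hi)
      linarith [h.2]
    · have := hT.2.1.monotone (Fin.succ_le_castSucc_iff.2 hi)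
      linarith [h.1]
  · simp

section

attribute [local instance] Matrix.linftyOpNormedRing Matrix.linftyOpNormedAlgebra

lemma hasDerivAt_evolveFor {N : ℕ} (H : Operator N) (τ : ℝ) :
    HasDerivAt (fun τ => evolveFor τ H) ((-Complex.I • H) * evolveFor τ H) τ :=
  hasDerivAt_exp_smul_const' (-Complex.I • H) τ

lemma hasDerivAt_evolveFor_mul {N : ℕ} (H V : Operator N) (a t : ℝ) :
    HasDerivAt (fun t => evolveFor (t - a) H * V)
      ((-Complex.I • H) * (evolveFor (t - a) H * V)) t := by
  have h := ((hasDerivAt_evolveFor H (t - a)).comp_sub_const t a).mul_const V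
  rwa [mul_assoc] at h

/-- `dU(0, t)/dt = -i H(t) U(0, t)` (derivative from the right, since `H` may jump at the switching
times). -/
theorem hasDerivWithinAt_evolution {n N : ℕ} {T : Fin (n + 1) → ℝ} (hT : IsTimePartition T)
    (H : Fin n → Operator N) {t : ℝ} (ht : 0 ≤ t) :
    HasDerivWithinAt (evolution T H) (-Complex.I • (floquetHamiltonian T H t * evolution T H t))
      (Set.Ici t) t := by
  have hm : ((⌊t⌋₊ : ℕ) : ℝ) + Int.fract t = t := by
    rw [natCast_floor_eq_intCast_floor ht]; exact Int.floor_add_fract t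
  obtain ⟨j, h0, h1⟩ : ∃ j : Fin n, T j.castSucc ≤ Int.fract t ∧ Int.fract t < T j.succ := by
    by_contra! hc
    have : ∀ i, T i ≤ Int.fract t := fun i =>
      Fin.induction (by rw [hT.1]; exact Int.fract_nonneg t) hc i
    linarith [this (Fin.last n), hT.2.2, Int.fract_lt_one t]
  have h := (hasDerivAt_evolveFor_mul (H j) (evolution T H t) t t).hasDerivWithinAt
    (s := Set.Ici t)
  rw [floquetHamiltonian_eq hT H j h0 h1]
  rw [sub_self, evolveFor_zero, one_mul, smul_mul_assoc] at h
  refine h.congr_of_eventuallyEq_of_mem ?_ Set.self_mem_Ici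
  have hnhds : Set.Iio (t + (T j.succ - Int.fract t)) ∈ 𝓝[≥] t :=
    mem_nhdsWithin_of_mem_nhds (Iio_mem_nhds (by linarith))
  filter_upwards [hnhds, self_mem_nhdsWithin] with x hx hx'
  have h2 := evolution_step hT H ⌊t⌋₊ j (s := Int.fract t) (s' := Int.fract t + (x - t)) h0
    (by linarith [Set.mem_Ici.1 hx']) (by linarith [Set.mem_Iio.1 hx])
  rw [← add_assoc, hm] at h2
  simpa using h2

/-- `t ↦ U(0, t)` is continuous on `[0, ∞)`. -/
theorem continuousOn_evolution {n N : ℕ} {T : Fin (n + 1) → ℝ} (hT : IsTimePartition T)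
    (H : Fin n → Operator N) : ContinuousOn (evolution T H) (Set.Ici 0) := by
  intro t ht
  have hright := (hasDerivWithinAt_evolution hT H ht).continuousWithinAt
  rcases (Set.mem_Ici.1 ht).eq_or_lt with rfl | hpos
  · exact hright
  obtain ⟨m, s, hs0, hs1, rfl⟩ : ∃ (m : ℕ) (s : ℝ), 0 < s ∧ s ≤ 1 ∧ t = m + s := by
    have h1 := Nat.ceil_lt_add_one hpos.le
    have h2 := Nat.le_ceil t
    obtain ⟨m, hm⟩ := Nat.exists_eq_succ_of_ne_zero (Nat.ceil_pos.2 hpos).ne'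
    rw [hm] at h1 h2
    push_cast at h1 h2
    exact ⟨m, t - m, by linarith, by linarith, by ring⟩
  obtain ⟨j, h0, h1⟩ : ∃ j : Fin n, T j.castSucc < s ∧ s ≤ T j.succ := by
    by_contra! hc
    have : ∀ i, T i < s := fun i => Fin.induction (by rw [hT.1]; exact hs0) hc i
    linarith [this (Fin.last n), hT.2.2]
  have hleft : ContinuousWithinAt (evolution T H) (Set.Iic (m + s)) (m + s) := by
    have h := (hasDerivAt_evolveFor_mul (H j) (evolution T H (m + T j.castSucc))
      (m + T j.castSucc) (m + s)).continuousAt.continuousWithinAt (s := Set.Iic (m + s))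
    refine h.congr_of_eventuallyEq_of_mem ?_ Set.self_mem_Iic
    have hnhds : Set.Ioi (m + T j.castSucc) ∈ 𝓝[≤] (m + s) :=
      mem_nhdsWithin_of_mem_nhds (Ioi_mem_nhds (by linarith))
    filter_upwards [hnhds, self_mem_nhdsWithin] with x hx hx'
    have h2 := evolution_step hT H m j (s := T j.castSucc) (s' := x - m) le_rfl
      (by linarith [Set.mem_Ioi.1 hx]) (by linarith [Set.mem_Iic.1 hx'])
    rw [add_sub_cancel, sub_sub] at h2
    exact h2
  exact (continuousAt_iff_continuous_left_right.2 ⟨hleft, hright⟩).continuousWithinAt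

end

/-! ## Haar-random product states -/

/-- The Haar measure on the pure states of one qubit: the uniform probability measure on the unit
sphere of `ℂ²`. -/
noncomputable def haarQubit : Measure (Metric.sphere (0 : EuclideanSpace ℂ (Fin 2)) 1) :=
  ((volume : Measure (EuclideanSpace ℂ (Fin 2))).toSphere Set.univ)⁻¹ •
    (volume : Measure (EuclideanSpace ℂ (Fin 2))).toSphere

instance haarQubit.isProbabilityMeasure : IsProbabilityMeasure haarQubit := ⟨by
  rw [haarQubit, Measure.smul_apply, smul_eq_mul]
  refine ENNReal.inv_mul_cancel ?_ (measure_ne_top _ _)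
  rw [Measure.toSphere_apply_univ]
  refine mul_ne_zero ?_ (Metric.measure_ball_pos _ _ one_pos).ne'
  exact_mod_cast (Module.finrank_pos (R := ℝ) (M := EuclideanSpace ℂ (Fin 2))).ne'⟩

/-- The law of `N` independent Haar-random one-qubit states. -/
noncomputable def haarProduct (N : ℕ) :
    Measure (Fin N → Metric.sphere (0 : EuclideanSpace ℂ (Fin 2)) 1) :=
  Measure.pi fun _ => haarQubit

instance haarProduct.isProbabilityMeasure (N : ℕ) : IsProbabilityMeasure (haarProduct N) := by
  unfold haarProduct; infer_instance

/-- The product state `⊗_l |φ_l⟩`. -/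
def productState {N : ℕ} (φ : Fin N → Metric.sphere (0 : EuclideanSpace ℂ (Fin 2)) 1) :
    Config N → ℂ :=
  fun s => ∏ l : Fin N, (φ l).1 (s l)

/-! ## Observables and approximate periodicity -/

/-- The operator norm with respect to the Euclidean norm of the Hilbert space. -/
noncomputable def operatorNorm {N : ℕ} (A : Operator N) : ℝ :=
  ‖Matrix.toEuclideanCLM (𝕜 := ℂ) A‖

/-- `⟨ψ|A|ψ⟩`, which is a real number for Hermitian `A`. -/
noncomputable def expectation {N : ℕ} (A : Operator N) (ψ : Config N → ℂ) : ℝ :=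
  (star ψ ⬝ᵥ A.mulVec ψ).re

/-- `f : ℝ → ℝ` is `ε`-periodic (with period `1`): for some measurable `fbar` on `[0, 1)`, the lower
density of the periods `[m, m + 1)` in which the squared `L²` distance of `f` from `fbar` is at most
`ε` is at least `1 - ε`. Only the values of `fbar` on `[0, 1)` are used; the integrability condition
excludes the value `0` that Lean assigns to undefined integrals. -/
def IsApproxPeriodic (ε : ℝ) (f : ℝ → ℝ) : Prop :=
  ∃ fbar : ℝ → ℝ, Measurable fbar ∧
    1 - ε ≤ liminf (fun M : ℕ =>
      (1 / (M : ℝ)) * (({m : ℕ | m < M ∧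
        IntegrableOn (fun x : ℝ => |f (m + x) - fbar x| ^ 2) (Set.Ico 0 1) ∧
        ∫ x in Set.Ico (0 : ℝ) 1, |f (m + x) - fbar x| ^ 2 ≤ ε}.ncard : ℕ) : ℝ)) atTop

/-! Let `U_F = U(0,1)` have eigenvalues `z_a` and orthonormal eigenvectors, and let `c_a` be the
amplitudes of the initial state in this basis. Then `⟨A⟩` at time `m + x` equals `∑ conj(c_a) c_b
B_ab(x) (conj(z_a) z_b)^m`, where `B(x)` is `A` conjugated by a unitary. The diagonal part is
independent of `m` and serves as `fbar`. If the gaps of `U_F` are nondegenerate, the off-diagonal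
frequencies are pairwise distinct, so the mean square of the remainder over long times is the sum of
the squared off-diagonal coefficients. Since `‖A‖ = 1`, this is at most the inverse participation
ratio `∑ |c_a|^4`. Markov's inequality in `m` turns this into approximate periodicity
(`isApproxPeriodic_expectation`).

For a Haar-random product state the fourth moment of an overlap with a unit vector is at most
`3^(-N)`, by induction over the qubits (`integral_haarProduct_norm_pow_four_le`). Summed over the
`2^N` eigenvectors this gives a mean participation ratio of at most `(2/3)^N`, and Markov's
inequality in the state yields the probability.

It remains to show that gaps are nondegenerate for almost all parameters. Nondegeneracy means that
`gapDiscriminant` is nonzero. This is a polynomial in the entries of `U_F` and hence analytic in the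
parameters, so by `AnalyticOnNhd.ae_ne_zero` a single good point suffices. At that point only the
first piece acts, for a short effective time, and its Hamiltonian is an Ising chain in a tilted
field. Such a chain with nondegenerate gaps is built qubit by qubit: `IsGenericPair.exists_coupling`
attaches a new qubit in a strong tilted field by a weak `zz` coupling, and first-order perturbation
theory lifts the remaining degeneracies. To keep the induction going, `σ^z` of the end qubit must
also have distinct expectations in the eigenvectors. -/

/-! ## Zero sets of analytic functions -/

/-- A real-analytic function on a finite-dimensional space that does not vanish identically is
nonzero almost everywhere. -/
theorem AnalyticOnNhd.ae_ne_zero {E : Type*} [NormedAddCommGroup E] [NormedSpace ℝ E]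
    [FiniteDimensional ℝ E] [MeasurableSpace E] [BorelSpace E] (μ : Measure E)
    [μ.IsAddHaarMeasure] {f : E → ℂ} (hf : AnalyticOnNhd ℝ f Set.univ) {p₀ : E} (h : f p₀ ≠ 0) :
    ∀ᵐ p ∂μ, f p ≠ 0 := by
  have hc : Continuous f := continuousOn_univ.1 hf.continuousOn
  -- On a line through `p₀` the function is analytic in one variable and nonzero at `t = 0`, so its
  -- zeros are discrete.
  have hline : ∀ v : E, ∀ᵐ t : ℝ, f (p₀ + t • v) ≠ 0 := fun v => by
    have ha : AnalyticOnNhd ℝ (fun t : ℝ => f (p₀ + t • v)) Set.univ := fun t _ =>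
      (hf _ trivial).comp
        (f := fun t : ℝ => p₀ + t • v) (analyticAt_const.add (analyticAt_id.smul analyticAt_const))
    have hz := ha.preimage_zero_mem_codiscrete (x := 0) (by simpa using h)
    have := ae_restrict_le_codiscreteWithin (μ := volume) MeasurableSet.univ hz
    rwa [Measure.restrict_univ] at this
  -- By Fubini some `t ≠ 0` is good for almost every `v`; dilation by `t` and translation by `p₀`
  -- preserve null sets.
  have hae : ∀ᵐ t : ℝ, ∀ᵐ v ∂μ, f (p₀ + t • v) ≠ 0 := by
    refine (Measure.ae_ae_comm ?_).2 (ae_of_all _ hline)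
    exact (isOpen_compl_singleton.preimage (f := fun q : ℝ × E => f (p₀ + q.1 • q.2))
      (by fun_prop)).measurableSet
  obtain ⟨t, ht, ht0⟩ := (hae.and (Measure.ae_ne volume (0 : ℝ))).exists
  have h1 : μ ((fun v => t • v) ⁻¹' {w | f (p₀ + w) = 0}) = 0 := by
    simpa [ae_iff] using ht
  rw [Measure.addHaar_preimage_smul μ ht0, mul_eq_zero] at h1
  have h2 : μ {w | f (p₀ + w) = 0} = 0 :=
    h1.resolve_left (by simp [ht0])
  have h3 := measure_preimage_add μ p₀ {w | f w = 0}
  rw [ae_iff]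
  simpa [← h3] using h2

/-! ## Time averages of almost periodic functions -/

/-- For `w ≠ 1` the geometric sums stay bounded by `2 / ‖w - 1‖`, so only the resonant case survives
averaging. -/
lemma tendsto_average_pow {w : ℂ} (hw : ‖w‖ = 1) :
    Tendsto (fun M : ℕ => (1 / (M : ℂ)) * ∑ m ∈ Finset.range M, w ^ m) atTop
      (𝓝 (if w = 1 then 1 else 0)) := by
  split_ifs with h
  · subst h
    refine tendsto_const_nhds.congr' ?_
    filter_upwards [eventually_gt_atTop 0] with M hM
    have : (M : ℂ) ≠ 0 := by exact_mod_cast hM.ne'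
    simp [this]
  · have hw1 : 0 < ‖w - 1‖ := norm_pos_iff.2 (sub_ne_zero.2 h)
    refine squeeze_zero_norm (a := fun M : ℕ => (2 / ‖w - 1‖) * (M : ℝ)⁻¹) (fun M => ?_) ?_
    · rw [geom_sum_eq h, norm_mul, norm_div, norm_div, norm_one, Complex.norm_natCast]
      have : ‖w ^ M - 1‖ ≤ 2 := (norm_sub_le _ _).trans (by simp [hw]; norm_num)
      rw [mul_comm, one_div]
      gcongr
    · simpa using tendsto_inv_atTop_nhds_zero_nat.const_mul (2 / ‖w - 1‖)

/-- Time averages of the mean square of a trigonometric polynomial with distinct frequencies and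
continuous coefficients. -/
theorem tendsto_average_integral_norm_sq {ι : Type*} [Fintype ι] {ζ : ι → ℂ}
    (hζ : Function.Injective ζ) (hn : ∀ i, ‖ζ i‖ = 1) {b : ι → ℝ → ℂ} (hb : ∀ i, Continuous (b i)) :
    Tendsto (fun M : ℕ => (1 / (M : ℝ)) * ∑ m ∈ Finset.range M,
        ∫ x in Set.Ico (0 : ℝ) 1, ‖∑ i, b i x * ζ i ^ m‖ ^ 2) atTop
      (𝓝 (∑ i, ∫ x in Set.Ico (0 : ℝ) 1, ‖b i x‖ ^ 2)) := by
  classical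
  have hint : ∀ i j, IntegrableOn (fun x => b i x * (starRingEnd ℂ) (b j x)) (Set.Ico 0 1) :=
    fun i j => ((by fun_prop : Continuous fun x => b i x * (starRingEnd ℂ) (b j x)).integrableOn_Icc
      (a := 0) (b := 1)).mono_set Set.Ico_subset_Icc_self
  set K : ι → ι → ℂ := fun i j => ∫ x in Set.Ico (0 : ℝ) 1, b i x * (starRingEnd ℂ) (b j x) with hK
  -- Expanding the square leaves powers of the ratios `ζ i / ζ j`; by injectivity of `ζ` only the
  -- diagonal terms are resonant.
  have hexp : ∀ m : ℕ, ((∫ x in Set.Ico (0 : ℝ) 1, ‖∑ i, b i x * ζ i ^ m‖ ^ 2 : ℝ) : ℂ) =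
      ∑ i, ∑ j, K i j * (ζ i * (starRingEnd ℂ) (ζ j)) ^ m := fun m => by
    rw [← integral_complex_ofReal]
    have : ∀ x : ℝ, ((‖∑ i, b i x * ζ i ^ m‖ ^ 2 : ℝ) : ℂ) = ∑ i, ∑ j,
        (b i x * (starRingEnd ℂ) (b j x)) * (ζ i * (starRingEnd ℂ) (ζ j)) ^ m := fun x => by
      push_cast
      rw [← Complex.mul_conj', map_sum, Finset.sum_mul_sum]
      refine Finset.sum_congr rfl fun i _ => Finset.sum_congr rfl fun j _ => ?_
      rw [map_mul, map_pow]
      ring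
    simp_rw [this]
    rw [integral_finsetSum _ fun i _ => integrable_finsetSum _ fun j _ => (hint i j).mul_const _]
    refine Finset.sum_congr rfl fun i _ => ?_
    rw [integral_finsetSum _ fun j _ => (hint i j).mul_const _]
    exact Finset.sum_congr rfl fun j _ => integral_mul_const _ _
  have hlim : Tendsto (fun M : ℕ => ∑ i, ∑ j, K i j * ((1 / (M : ℂ)) *
      ∑ m ∈ Finset.range M, (ζ i * (starRingEnd ℂ) (ζ j)) ^ m)) atTop
      (𝓝 (∑ i, ∑ j, K i j * if ζ i * (starRingEnd ℂ) (ζ j) = 1 then 1 else 0)) :=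
    tendsto_finsetSum _ fun i _ => tendsto_finsetSum _ fun j _ =>
      (tendsto_average_pow (by simp [hn])).const_mul _
  have hij : ∀ i j, ζ i * (starRingEnd ℂ) (ζ j) = 1 ↔ i = j := fun i j => by
    have h1 : (starRingEnd ℂ) (ζ j) = (ζ j)⁻¹ := by rw [Complex.inv_eq_conj (hn j)]
    have h0 : ζ j ≠ 0 := norm_ne_zero_iff.1 (by simp [hn])
    rw [h1, mul_inv_eq_one₀ h0, hζ.eq_iff]
  have hdiag : ∀ i, K i i = ((∫ x in Set.Ico (0 : ℝ) 1, ‖b i x‖ ^ 2 : ℝ) : ℂ) := fun i => by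
    rw [← integral_complex_ofReal]
    simp [hK, Complex.mul_conj']
  simp only [hij, mul_ite, mul_one, mul_zero, Finset.sum_ite_eq, Finset.mem_univ, if_true,
    hdiag] at hlim
  rw [← Complex.ofReal_sum] at hlim
  refine (Complex.continuous_re.continuousAt.tendsto.comp hlim).congr fun M => ?_
  have : ∑ i, ∑ j, K i j * ((1 / (M : ℂ)) *
      ∑ m ∈ Finset.range M, (ζ i * (starRingEnd ℂ) (ζ j)) ^ m) =
      (((1 / (M : ℝ)) * ∑ m ∈ Finset.range M,
        ∫ x in Set.Ico (0 : ℝ) 1, ‖∑ i, b i x * ζ i ^ m‖ ^ 2 : ℝ) : ℂ) := by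
    rw [Complex.ofReal_mul, Complex.ofReal_sum]
    simp_rw [hexp, Finset.mul_sum]
    rw [Finset.sum_comm (s := Finset.range M)]
    refine Finset.sum_congr rfl fun i _ => ?_
    rw [Finset.sum_comm (s := Finset.range M)]
    refine Finset.sum_congr rfl fun j _ => Finset.sum_congr rfl fun m _ => ?_
    push_cast
    ring
  simp only [Function.comp_apply, this, Complex.ofReal_re]

/-- Markov's inequality for densities of sets of natural numbers. -/
theorem one_sub_le_liminf_density {u : ℕ → ℝ} (hu : ∀ m, 0 ≤ u m) {L ε : ℝ} (hε : 0 < ε)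
    (hL : L ≤ ε ^ 2)
    (h : Tendsto (fun M : ℕ => (1 / (M : ℝ)) * ∑ m ∈ Finset.range M, u m) atTop (𝓝 L))
    {S : ℕ → Prop} (hS : ∀ m, u m ≤ ε → S m) :
    1 - ε ≤ liminf (fun M : ℕ => (1 / (M : ℝ)) * (({m : ℕ | m < M ∧ S m}.ncard : ℕ) : ℝ))
      atTop := by
  classical
  have hset : ∀ M : ℕ, {m : ℕ | m < M ∧ S m} = ((Finset.range M).filter S : Finset ℕ) := fun M => by
    ext; simp
  have h1 : Tendsto (fun M : ℕ => 1 - (1 / ε) * ((1 / (M : ℝ)) * ∑ m ∈ Finset.range M, u m)) atTop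
      (𝓝 (1 - (1 / ε) * L)) := (h.const_mul _).const_sub _
  have h2 : 1 - ε ≤ 1 - (1 / ε) * L := by
    have : (1 / ε) * L ≤ ε := by
      rw [one_div, inv_mul_le_iff₀ hε]; nlinarith
    linarith
  refine h2.trans ?_
  rw [← h1.liminf_eq]
  refine liminf_le_liminf ?_ h1.isBoundedUnder_ge ?_
  · filter_upwards [eventually_gt_atTop 0] with M hM
    have hM' : (0 : ℝ) < M := by exact_mod_cast hM
    rw [hset, Set.ncard_coe_finset]
    -- Each `m` outside `S` contributes more than `ε`, so the bad density is at most `L / ε ≤ ε` in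
    -- the limit.
    have hsum : ε * (((Finset.range M).filter fun m => ¬ S m).card : ℝ) ≤
        ∑ m ∈ Finset.range M, u m := by
      rw [mul_comm, ← nsmul_eq_mul]
      refine (Finset.card_nsmul_le_sum _ u ε fun m hm => ?_).trans
        (Finset.sum_le_sum_of_subset_of_nonneg (Finset.filter_subset _ _) fun m _ _ => hu m)
      exact (not_le.1 (mt (hS m) (Finset.mem_filter.1 hm).2)).le
    have hcard : (((Finset.range M).filter S).card : ℝ) +
        (((Finset.range M).filter fun m => ¬ S m).card : ℝ) = M := by
      exact_mod_cast (Finset.card_filter_add_card_filter_not _).trans (Finset.card_range M)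
    have : (1 / ε) * ((1 / (M : ℝ)) * ∑ m ∈ Finset.range M, u m) ≥
        (1 / (M : ℝ)) * (((Finset.range M).filter fun m => ¬ S m).card : ℝ) := by
      have := mul_le_mul_of_nonneg_left hsum (by positivity : 0 ≤ (1 / ε) * (1 / (M : ℝ)))
      have e : (1 / ε) * (1 / (M : ℝ)) * (ε *
        (((Finset.range M).filter fun m => ¬ S m).card : ℝ)) = (1 / (M : ℝ)) *
        (((Finset.range M).filter fun m => ¬ S m).card : ℝ) := by field_simp
      linarith
    have e1 : (1 / (M : ℝ)) * M = 1 := by field_simp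
    have := congrArg (fun r => (1 / (M : ℝ)) * r) hcard
    simp only [mul_add, e1] at this
    linarith
  -- Comparing real-valued `liminf`s needs an upper bound on the larger sequence: a proportion is at
  -- most `1`.
  · refine IsBoundedUnder.isCoboundedUnder_ge ⟨1, ?_⟩
    simp only [eventually_map]
    filter_upwards [eventually_gt_atTop 0] with M hM
    have hM' : (0 : ℝ) < M := by exact_mod_cast hM
    rw [hset, Set.ncard_coe_finset, one_div, inv_mul_le_iff₀ hM', mul_one]
    exact_mod_cast (Finset.card_filter_le _ _).trans_eq (Finset.card_range M)

/-! ## First-order perturbation theory -/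

/-- Near a diagonal matrix with simple spectrum the eigenvectors, normalised by `v k = 1`, and the
eigenvalues of a linear family of matrices are differentiable functions. -/
theorem exists_eigenpair_hasDerivAt {κ : Type*} [Fintype κ] [DecidableEq κ] {e : κ → ℝ}
    (he : Function.Injective e) (V : Matrix κ κ ℂ) (k : κ) :
    ∃ (v : ℝ → κ → ℂ) (l : ℝ → ℂ), v 0 = Pi.single k 1 ∧ l 0 = e k ∧
      HasDerivAt l (V k k) 0 ∧
      (∀ j, HasDerivAt (fun J => v J j) (if j = k then 0 else V j k / (e k - e j)) 0) ∧
      ∀ᶠ J : ℝ in 𝓝 0,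
        (Matrix.diagonal (fun j => (e j : ℂ)) + (J : ℂ) • V).mulVec (v J) = l J • v J := by
  -- The eigenvalue equation together with the normalisation `v k = 1` reads `F = (0, 1)`; the
  -- implicit function theorem solves it for `(v, l)` near `J = 0`.
  let F : ℝ × ((κ → ℂ) × ℂ) → (κ → ℂ) × ℂ := fun q =>
    (fun j => (e j : ℂ) * q.2.1 j + (q.1 : ℂ) * (∑ i, V j i * q.2.1 i) - q.2.2 * q.2.1 j, q.2.1 k)
  have hF : ContDiff ℝ 1 F := by
    refine ContDiff.prodMk (contDiff_pi.2 fun j => ?_) (by fun_prop)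
    have h1 : ContDiff ℝ 1 fun q : ℝ × ((κ → ℂ) × ℂ) => (q.1 : ℂ) :=
      Complex.ofRealCLM.contDiff.comp contDiff_fst
    have h2 : ContDiff ℝ 1 fun q : ℝ × ((κ → ℂ) × ℂ) => ∑ i, V j i * q.2.1 i :=
      ContDiff.sum fun i _ => by fun_prop
    exact (ContDiff.add (by fun_prop) (h1.mul h2)).sub (by fun_prop)
  set u : ℝ × ((κ → ℂ) × ℂ) := (0, (Pi.single k 1, (e k : ℂ))) with hu
  have hs : HasStrictFDerivAt F (fderiv ℝ F u) u := hF.contDiffAt.hasStrictFDerivAt (by norm_num)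
  -- The derivative of `F` at `u` is computed by differentiating along curves through `u`. Straight
  -- lines then give injectivity of the partial derivative, and the implicit curve gives the
  -- perturbation formulas.
  have hchain : ∀ (J : ℝ → ℝ) (v : ℝ → κ → ℂ) (l : ℝ → ℂ) (J' : ℝ) (v' : κ → ℂ) (l' : ℂ),
      HasDerivAt J J' 0 → HasDerivAt v v' 0 → HasDerivAt l l' 0 → J 0 = 0 →
      v 0 = Pi.single k 1 → l 0 = e k → fderiv ℝ F u (J', (v', l')) =
        (fun j => ((e j : ℂ) - e k) * v' j + J' * V j k - l' * (Pi.single k 1 : κ → ℂ) j,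
          v' k) := by
    intro J v l J' v' l' hJ hv hl hJ0 hv0 hl0
    have h0 : HasFDerivAt F (fderiv ℝ F u) (J 0, (v 0, l 0)) := by
      rw [hJ0, hv0, hl0]
      exact hs.hasFDerivAt
    have h1 : HasDerivAt (fun t => F (J t, (v t, l t))) (fderiv ℝ F u (J', (v', l'))) 0 :=
      h0.comp_hasDerivAt (0 : ℝ) (hJ.prodMk (hv.prodMk hl))
    refine h1.unique (HasDerivAt.prodMk (hasDerivAt_pi.2 fun j => ?_) (hasDerivAt_pi.1 hv k))
    have hvj := fun i => hasDerivAt_pi.1 hv i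
    have h2 := (((hvj j).const_mul (e j : ℂ)).add (hJ.ofReal_comp.mul
      (HasDerivAt.fun_sum fun i (_ : i ∈ Finset.univ) => (hvj i).const_mul (V j i)))).sub
      (hl.mul (hvj j))
    refine h2.congr_deriv ?_
    simp [hJ0, hv0, hl0, Pi.single_apply]
    ring
  -- In finite dimension injectivity suffices; it follows from `e j ≠ e k` for `j ≠ k`, with the
  -- normalisation component controlling `v' k`.
  have hinv : (fderiv ℝ F u ∘L .inr ℝ ℝ ((κ → ℂ) × ℂ)).IsInvertible := by
    have hinj : Function.Injective
        (fderiv ℝ F u ∘L .inr ℝ ℝ ((κ → ℂ) × ℂ) : ((κ → ℂ) × ℂ) →L[ℝ] (κ → ℂ) × ℂ).toLinearMap := by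
      rw [injective_iff_map_eq_zero]
      rintro ⟨v', l'⟩ h
      have h1 := hchain (fun _ => 0) (fun t => Pi.single k 1 + t • v') (fun t => e k + t • l') 0 v' l'
        (hasDerivAt_const _ _) ((((hasDerivAt_id (0 : ℝ)).smul_const v').const_add _).congr_deriv (one_smul _ _))
        ((((hasDerivAt_id (0 : ℝ)).smul_const l').const_add _).congr_deriv (one_smul _ _)) rfl (by simp) (by simp)
      have h2 : fderiv ℝ F u (0, (v', l')) = 0 := by simpa using h
      rw [h2, eq_comm, Prod.mk_eq_zero] at h1
      obtain ⟨h3, h4⟩ := h1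
      have h5 : l' = 0 := by simpa using congrFun h3 k
      refine Prod.ext (funext fun j => ?_) h5
      by_cases hj : j = k
      · rw [hj]; exact h4
      · have h6 : ((e j : ℂ) - e k) * v' j = 0 := by simpa [hj] using congrFun h3 j
        refine (mul_eq_zero.1 h6).resolve_left (sub_ne_zero.2 ?_)
        exact_mod_cast fun h => hj (he h)
    exact ⟨(LinearEquiv.ofInjectiveEndo _ hinj).toContinuousLinearEquiv, by ext <;> rfl⟩
  have hd := (hs.hasStrictFDerivAt_implicitFunctionOfProdDomain hinv).hasStrictDerivAt.hasDerivAt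
  have hev := hs.eventually_apply_implicitFunctionOfProdDomain hinv
  have h0 := (hs.tendsto_implicitFunctionOfProdDomain hinv)
  set ψ := hs.implicitFunctionOfProdDomain hinv with hψ
  have h00 : ψ 0 = (Pi.single k 1, (e k : ℂ)) := tendsto_nhds_unique hd.continuousAt.tendsto h0
  have hd' : HasDerivAt ψ _ 0 := hd
  obtain ⟨ψ', hψ'⟩ : ∃ ψ', HasDerivAt ψ ψ' 0 := ⟨_, hd'⟩
  have hv : HasDerivAt (fun t => (ψ t).1) ψ'.1 0 :=
    (ContinuousLinearMap.fst ℝ (κ → ℂ) ℂ).hasFDerivAt.comp_hasDerivAt 0 hψ'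
  have hl : HasDerivAt (fun t => (ψ t).2) ψ'.2 0 :=
    (ContinuousLinearMap.snd ℝ (κ → ℂ) ℂ).hasFDerivAt.comp_hasDerivAt 0 hψ'
  have hFu : F u = (0, 1) := by
    refine Prod.ext (funext fun j => ?_) (by simp [F, hu])
    by_cases hj : j = k <;> simp [F, hu, hj]
  have hder := hchain id _ _ 1 _ _ (hasDerivAt_id 0) hv hl rfl (by rw [h00]) (by rw [h00])
  have hz : fderiv ℝ F u (1, (ψ'.1, ψ'.2)) = 0 := by
    have h2 : HasFDerivAt F (fderiv ℝ F u) ((0 : ℝ), ψ 0) := by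
      rw [h00]
      exact hs.hasFDerivAt
    have h1 : HasDerivAt (fun t => F (t, ψ t)) (fderiv ℝ F u (1, ψ')) 0 :=
      h2.comp_hasDerivAt (0 : ℝ) ((hasDerivAt_id (0 : ℝ)).prodMk hψ')
    refine h1.unique ((hasDerivAt_const (0 : ℝ) (F u)).congr_of_eventuallyEq hev)
  rw [hz, eq_comm, Prod.mk_eq_zero] at hder
  have hlk : V k k = ψ'.2 := by
    have := congrFun hder.1 k
    simpa [sub_eq_zero] using this
  refine ⟨fun t => (ψ t).1, fun t => (ψ t).2, by simp [h00], by simp [h00], by rwa [hlk],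
    fun j => ?_, ?_⟩
  · refine (hasDerivAt_pi.1 hv j).congr_deriv ?_
    split_ifs with hj
    · rw [hj]; exact hder.2
    · have h6 : ((e j : ℂ) - e k) * ψ'.1 j + V j k = 0 := by simpa [hj] using congrFun hder.1 j
      have h7 : (e k : ℂ) - e j ≠ 0 := sub_ne_zero.2 (by exact_mod_cast fun h => hj (he h).symm)
      rw [eq_div_iff h7]
      linear_combination -h6
  · filter_upwards [hev] with J hJ
    have h1 := congrArg Prod.fst (hJ.trans hFu)
    funext j
    have h2 := congrFun h1 j
    simp only [F, Pi.zero_apply] at h2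
    rw [Matrix.add_mulVec, Pi.add_apply, Matrix.mulVec_diagonal, Matrix.smul_mulVec]
    simp only [Pi.smul_apply, smul_eq_mul, Matrix.mulVec, dotProduct]
    linear_combination h2

/-- First-order perturbation theory for a Hermitian matrix `D + J V` with `D` diagonal and of simple
spectrum: the eigenvalues `l k` and the expectations `z k` of a Hermitian matrix `W` in the
eigenvectors are differentiable in `J` at `0`. -/
theorem exists_eigenbasis_hasDerivAt {κ : Type*} [Fintype κ] [DecidableEq κ] {e : κ → ℝ}
    (he : Function.Injective e) {V W : Matrix κ κ ℂ} (hV : V.IsHermitian) (hW : W.IsHermitian) :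
    ∃ l z : κ → ℝ → ℝ, (∀ k, l k 0 = e k) ∧ (∀ k, HasDerivAt (l k) (V k k).re 0) ∧
      (∀ k, z k 0 = (W k k).re) ∧
      (∀ k, HasDerivAt (z k)
        (2 * (∑ j, W k j * if j = k then 0 else V j k / (e k - e j)).re) 0) ∧
      ∀ᶠ J : ℝ in 𝓝 0, ∃ O ∈ Matrix.unitaryGroup κ ℂ,
        (Matrix.diagonal (fun j => (e j : ℂ)) + (J : ℂ) • V) * O =
          O * Matrix.diagonal (fun j => (l j J : ℂ)) ∧
        ∀ k, ((star O * W * O) k k).re = z k J := by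
  choose v μ hv0 hμ0 hμ hv hev using exists_eigenpair_hasDerivAt he V
  let n : κ → ℝ → ℝ := fun k J => ∑ j, Complex.normSq (v k J j)
  let w : κ → ℝ → ℂ := fun k J => ∑ i, star (v k J i) * ∑ j, W i j * v k J j
  have hn0 : ∀ k, n k 0 = 1 := fun k => by
    simp [n, hv0, Pi.single_apply, apply_ite Complex.normSq]
  have hw0 : ∀ k, w k 0 = W k k := fun k => by
    simp [w, hv0, Pi.single_apply]
  -- With `v k = 1` fixed, the first-order correction is orthogonal to the unperturbed vector. The
  -- squared norm is therefore stationary, and normalising does not affect first derivatives at `0`.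
  have hn : ∀ k, HasDerivAt (n k) 0 0 := fun k => by
    have h1 : ∀ j, HasDerivAt (fun J => star (v k J j) * v k J j) _ 0 := fun j =>
      (hv k j).star.mul (hv k j)
    have h2 : HasDerivAt (fun J => ∑ j, star (v k J j) * v k J j) _ 0 :=
      HasDerivAt.fun_sum fun j (_ : j ∈ Finset.univ) => h1 j
    have h3 := Complex.reCLM.hasFDerivAt.comp_hasDerivAt (0 : ℝ) h2
    refine (h3.congr_deriv ?_).congr_of_eventuallyEq (Eventually.of_forall fun J => ?_)
    · simp only [hv0, Complex.reCLM_apply, Complex.re_sum]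
      refine Finset.sum_eq_zero fun j _ => ?_
      by_cases hj : j = k <;> simp [hj]
    · simp only [n, Function.comp_apply, Complex.reCLM_apply, Complex.re_sum]
      refine Finset.sum_congr rfl fun j _ => ?_
      simp [Complex.normSq_apply]
  have hw : ∀ k, HasDerivAt (fun J => (w k J).re)
      (2 * (∑ j, W k j * if j = k then 0 else V j k / (e k - e j)).re) 0 := fun k => by
    have h2 : HasDerivAt (w k) _ 0 := HasDerivAt.fun_sum fun i (_ : i ∈ Finset.univ) =>
      (hv k i).star.mul (HasDerivAt.fun_sum fun j (_ : j ∈ Finset.univ) =>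
        (hv k j).const_mul (W i j))
    refine (Complex.reCLM.hasFDerivAt.comp_hasDerivAt (0 : ℝ) h2).congr_deriv ?_
    rw [Complex.reCLM_apply, Finset.sum_add_distrib, Complex.add_re]
    simp only [hv0, Pi.single_apply, apply_ite (star : ℂ → ℂ), star_one, star_zero, mul_ite, mul_one,
      mul_zero, ite_mul, one_mul, zero_mul, Finset.sum_ite_eq', Finset.mem_univ, if_true]
    rw [two_mul]
    congr 1
    rw [Complex.re_sum, Complex.re_sum]
    refine Finset.sum_congr rfl fun j _ => ?_
    split_ifs with h
    · rfl
    · rw [← hW.apply j k, ← Complex.conj_re]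
      simp [mul_comm]
  refine ⟨fun k J => (μ k J).re, fun k J => (w k J).re / n k J, fun k => by simp [hμ0],
    fun k => Complex.reCLM.hasFDerivAt.comp_hasDerivAt (0 : ℝ) (hμ k), fun k => by simp [hw0, hn0],
    fun k => ((hw k).div (hn k) (by simp [hn0])).congr_deriv (by simp [hn0]), ?_⟩
  have hpos : ∀ᶠ J : ℝ in 𝓝 0, ∀ k, 0 < n k J := eventually_all.2 fun k =>
    (hn k).continuousAt.eventually_const_lt (by rw [hn0]; exact one_pos)
  have hsep : ∀ᶠ J : ℝ in 𝓝 0, ∀ i j, i ≠ j → (μ i J).re ≠ (μ j J).re := by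
    refine eventually_all.2 fun i => eventually_all.2 fun j => ?_
    by_cases hij : i = j
    · simp [hij]
    · have hc : ContinuousAt (fun J => (μ i J).re - (μ j J).re) 0 :=
        (Complex.continuous_re.continuousAt.comp (hμ i).continuousAt).sub
          (Complex.continuous_re.continuousAt.comp (hμ j).continuousAt)
      have := hc.eventually_ne (y := (0 : ℝ))
        (by simpa [hμ0, sub_eq_zero] using fun h => hij (he h))
      filter_upwards [this] with J hJ _ h
      exact hJ (sub_eq_zero.2 h)
  filter_upwards [eventually_all.2 hev, hpos, hsep] with J hJ hnJ hsJ
  set M := Matrix.diagonal (fun j => (e j : ℂ)) + (J : ℂ) • V with hM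
  have hMH : M.IsHermitian := by
    refine Matrix.IsHermitian.add (Matrix.isHermitian_diagonal_of_self_adjoint _ ?_) ?_
    · ext; simp
    · rw [Matrix.IsHermitian, Matrix.conjTranspose_smul, hV.eq]; simp
  have hself : ∀ k, star (v k J) ⬝ᵥ v k J = (n k J : ℂ) := fun k => by
    simp [n, dotProduct, Complex.normSq_eq_conj_mul_self]
  -- Hermiticity of `M` makes the eigenvalues real and, since they are distinct near `J = 0`, the
  -- eigenvectors orthogonal.
  have hsym : ∀ i j, (μ j J) * (star (v i J) ⬝ᵥ v j J) =
      star (μ i J) * (star (v i J) ⬝ᵥ v j J) := fun i j => by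
    have h1 : star (v i J) ⬝ᵥ M.mulVec (v j J) = star (M.mulVec (v i J)) ⬝ᵥ v j J := by
      rw [Matrix.star_mulVec, hMH.eq, Matrix.dotProduct_mulVec]
    rw [hJ, hJ, star_smul, dotProduct_smul, smul_dotProduct] at h1
    exact h1
  have hreal : ∀ k, ((μ k J).re : ℂ) = μ k J := fun k => by
    have h1 := hsym k k
    rw [hself] at h1
    have h2 := mul_right_cancel₀ (by exact_mod_cast (hnJ k).ne') h1
    exact Complex.conj_eq_iff_re.1 h2.symm
  have horth : ∀ i j, i ≠ j → star (v i J) ⬝ᵥ v j J = 0 := fun i j hij => by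
    have h1 := hsym i j
    rw [← hreal i, ← hreal j, ← sub_eq_zero, ← sub_mul] at h1
    refine (mul_eq_zero.1 h1).resolve_left fun h => hsJ i j hij ?_
    rw [sub_eq_zero] at h
    simpa using h.symm
  let O : Matrix κ κ ℂ := Matrix.of fun j k => v k J j * ((Real.sqrt (n k J) : ℝ) : ℂ)⁻¹
  have hs : ∀ k, ((Real.sqrt (n k J) : ℝ) : ℂ) * ((Real.sqrt (n k J) : ℝ) : ℂ) = n k J := fun k => by
    exact_mod_cast Real.mul_self_sqrt (hnJ k).le
  have hs0 : ∀ k, ((Real.sqrt (n k J) : ℝ) : ℂ) ≠ 0 := fun k => by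
    exact_mod_cast (Real.sqrt_pos.2 (hnJ k)).ne'
  have hgen : ∀ (B : Matrix κ κ ℂ) i j, (star O * B * O) i j =
      (star (v i J) ⬝ᵥ B.mulVec (v j J)) *
        (((Real.sqrt (n i J) : ℝ) : ℂ)⁻¹ * ((Real.sqrt (n j J) : ℝ) : ℂ)⁻¹) := fun B i j => by
    rw [Matrix.mul_assoc, Matrix.mul_apply]
    simp only [Matrix.star_apply, Matrix.mul_apply, O, Matrix.of_apply, dotProduct, Matrix.mulVec,
      Pi.star_apply, star_mul', star_inv₀, Finset.sum_mul, Finset.mul_sum]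
    refine Finset.sum_congr rfl fun a _ => Finset.sum_congr rfl fun b _ => ?_
    simp only [RCLike.star_def, Complex.conj_ofReal]
    ring
  refine ⟨O, ?_, ?_, fun k => ?_⟩
  · rw [Matrix.mem_unitaryGroup_iff']
    ext i j
    have h1 := hgen 1 i j
    rw [Matrix.mul_one, Matrix.one_mulVec] at h1
    rw [h1]
    by_cases hij : i = j
    · subst hij
      rw [hself, ← hs, Matrix.one_apply_eq]
      field_simp [hs0 i]
    · rw [horth i j hij, zero_mul, Matrix.one_apply_ne hij]
  · ext j k
    rw [Matrix.mul_diagonal, hreal]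
    have h1 := congrFun (hJ k) j
    simp only [Matrix.mulVec, dotProduct, Pi.smul_apply, smul_eq_mul] at h1
    simp only [Matrix.mul_apply, O, Matrix.of_apply, ← mul_assoc]
    rw [← Finset.sum_mul, h1]
    ring
  · rw [hgen, ← mul_inv, hs, ← Complex.ofReal_inv, Complex.re_mul_ofReal, ← div_eq_mul_inv]
    rfl

/-! ## Generic pairs of operators -/

/-- `H` has an eigenbasis with simple spectrum and nondegenerate gaps, in which the diagonal matrix
elements of `Z` are pairwise distinct. -/
def IsGenericPair {κ : Type*} [Fintype κ] [DecidableEq κ] (H Z : Matrix κ κ ℂ) : Prop :=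
  ∃ O ∈ Matrix.unitaryGroup κ ℂ, ∃ E : κ → ℝ,
    H * O = O * Matrix.diagonal (fun j => (E j : ℂ)) ∧
    (∀ a b c d, E a + E b = E c + E d → s(a, b) = s(c, d)) ∧
    Function.Injective fun a => ((star O * Z * O) a a).re

/-- Distinct values separate by continuity. If the values agree, distinct slopes separate the
functions off `0`, which is why the neighbourhood is punctured. -/
lemma eventually_ne_of_hasDerivAt {f g : ℝ → ℝ} {f' g' : ℝ} (hf : HasDerivAt f f' 0)
    (hg : HasDerivAt g g' 0) (h : f 0 ≠ g 0 ∨ f' ≠ g') : ∀ᶠ J in 𝓝[≠] 0, f J ≠ g J := by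
  have hfg := hf.sub hg
  have : ∀ᶠ J in 𝓝[≠] 0, (f - g) J ≠ 0 := by
    rcases h with h | h
    · exact (hfg.continuousAt.eventually_ne (sub_ne_zero.2 h)).filter_mono nhdsWithin_le_nhds
    · exact hfg.eventually_ne (sub_ne_zero.2 h)
  filter_upwards [this] with J hJ h
  exact hJ (sub_eq_zero.2 h)

/-- Degeneracies that are lifted to first order are lifted for small perturbations. -/
theorem eventually_isGenericPair {κ : Type*} [Fintype κ] [DecidableEq κ] {e : κ → ℝ}
    (he : Function.Injective e) {V W : Matrix κ κ ℂ} (hV : V.IsHermitian) (hW : W.IsHermitian)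
    (h1 : ∀ a b c d, e a + e b = e c + e d →
      (V a a).re + (V b b).re = (V c c).re + (V d d).re → s(a, b) = s(c, d))
    (h2 : ∀ a b, (W a a).re = (W b b).re →
      (∑ j, W a j * if j = a then 0 else V j a / (e a - e j)).re =
        (∑ j, W b j * if j = b then 0 else V j b / (e b - e j)).re → a = b) :
    ∀ᶠ J : ℝ in 𝓝[≠] 0,
      IsGenericPair (Matrix.diagonal (fun j => (e j : ℂ)) + (J : ℂ) • V) W := by
  obtain ⟨l, z, hl0, hl, hz0, hz, hev⟩ := exists_eigenbasis_hasDerivAt he hV hW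
  have hA : ∀ᶠ J : ℝ in 𝓝[≠] 0, ∀ a b c d, s(a, b) ≠ s(c, d) →
      l a J + l b J ≠ l c J + l d J := by
    refine eventually_all.2 fun a => eventually_all.2 fun b => eventually_all.2 fun c =>
      eventually_all.2 fun d => ?_
    by_cases hs : s(a, b) = s(c, d)
    · simp [hs]
    · refine (eventually_ne_of_hasDerivAt ((hl a).add (hl b)) ((hl c).add (hl d)) ?_).mono
        fun J hJ _ => hJ
      by_contra! hc
      exact hs (h1 a b c d (by simpa [hl0] using hc.1) hc.2)
  have hB : ∀ᶠ J : ℝ in 𝓝[≠] 0, ∀ a b, a ≠ b → z a J ≠ z b J := by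
    refine eventually_all.2 fun a => eventually_all.2 fun b => ?_
    by_cases hs : a = b
    · simp [hs]
    · refine (eventually_ne_of_hasDerivAt (hz a) (hz b) ?_).mono fun J hJ _ => hJ
      by_contra! hc
      exact hs (h2 a b (by simpa [hz0] using hc.1) (mul_left_cancel₀ two_ne_zero hc.2))
  filter_upwards [hA, hB, hev.filter_mono nhdsWithin_le_nhds] with J hJA hJB ⟨O, hO, hd, hz⟩
  refine ⟨O, hO, fun k => l k J, hd, fun a b c d h => ?_, fun a b h => ?_⟩
  · by_contra hs
    exact hJA a b c d hs h
  · by_contra hs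
    simp only [hz] at h
    exact hJB a b hs h

lemma IsGenericPair.of_conj {κ : Type*} [Fintype κ] [DecidableEq κ] {H Z S : Matrix κ κ ℂ}
    (hS : S ∈ Matrix.unitaryGroup κ ℂ) (h : IsGenericPair (star S * H * S) (star S * Z * S)) :
    IsGenericPair H Z := by
  obtain ⟨O, hO, E, h1, h2, h3⟩ := h
  have hSS : S * star S = 1 := Matrix.mem_unitaryGroup_iff.1 hS
  refine ⟨S * O, mul_mem hS hO, E, ?_, h2, ?_⟩
  · calc H * (S * O) = (S * star S) * (H * (S * O)) := by rw [hSS, one_mul]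
      _ = S * ((star S * H * S) * O) := by simp only [mul_assoc]
      _ = _ := by rw [h1, mul_assoc]
  · simpa only [star_mul, mul_assoc] using h3

lemma IsGenericPair.submatrix {κ κ' : Type*} [Fintype κ] [DecidableEq κ] [Fintype κ']
    [DecidableEq κ'] {H Z : Matrix κ κ ℂ} (σ : κ' ≃ κ) (h : IsGenericPair H Z) :
    IsGenericPair (H.submatrix σ σ) (Z.submatrix σ σ) := by
  obtain ⟨O, hO, E, h1, h2, h3⟩ := h
  have hstar : star (O.submatrix σ σ) = (star O).submatrix σ σ := rfl
  refine ⟨O.submatrix σ σ, ?_, E ∘ σ, ?_, fun a b c d h => ?_, ?_⟩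
  · rw [Matrix.mem_unitaryGroup_iff] at hO ⊢
    rw [hstar, Matrix.submatrix_mul_equiv, hO, Matrix.submatrix_one_equiv]
  · rw [Matrix.submatrix_mul_equiv, h1, ← Matrix.submatrix_mul_equiv _ _ _ σ,
      Matrix.submatrix_diagonal_equiv]
    rfl
  · have := congrArg (Sym2.map σ.symm) (h2 _ _ _ _ h)
    simpa using this
  · rw [hstar, Matrix.submatrix_mul_equiv, Matrix.submatrix_mul_equiv]
    exact h3.comp σ.injective

/-- The rational reflection that is used to tilt the field on a qubit. -/
noncomputable def tilt : Matrix (Fin 2) (Fin 2) ℂ := !![4 / 5, 3 / 5; 3 / 5, -(4 / 5)]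

/-- `σ^z` in the eigenbasis of the tilted field. -/
noncomputable def tiltedZ : Matrix (Fin 2) (Fin 2) ℂ := !![7 / 25, 24 / 25; 24 / 25, -(7 / 25)]

lemma star_tilt : star tilt = tilt := by
  ext i j; fin_cases i <;> fin_cases j <;> simp [tilt]

lemma tilt_mul_tilt : tilt * tilt = 1 := by
  ext i j; fin_cases i <;> fin_cases j <;> simp [tilt] <;> norm_num

/-- The 3-4-5 angle keeps all entries rational and makes both kinds of entries of `tiltedZ` nonzero.
The diagonal `7/25` will split the energies, the off-diagonal `24/25` the expectations of `σ^z`. -/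
lemma tilt_mul_pauli_z_mul_tilt : tilt * pauli .z * tilt = tiltedZ := by
  ext i j; fin_cases i <;> fin_cases j <;> simp [tilt, pauli, tiltedZ] <;> norm_num

lemma tilt_mul_tiltedZ_mul_tilt :
    tilt * ((24 / 25 : ℂ) • pauli .x + (7 / 25 : ℂ) • pauli .z) * tilt = pauli .z := by
  ext i j; fin_cases i <;> fin_cases j <;> simp [tilt, pauli] <;> norm_num

lemma tiltedZ_isHermitian : tiltedZ.IsHermitian := by
  ext i j; fin_cases i <;> fin_cases j <;> simp [tiltedZ]

open scoped Kronecker in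
/-- Coupling one more qubit to a generic pair. -/
theorem IsGenericPair.exists_coupling {κ : Type*} [Fintype κ] [DecidableEq κ]
    {H Z : Matrix κ κ ℂ} (hZ : Z.IsHermitian) (h : IsGenericPair H Z) :
    ∃ f g J : ℝ, IsGenericPair
      ((f : ℂ) • (pauli .x ⊗ₖ (1 : Matrix κ κ ℂ)) + (g : ℂ) • (pauli .z ⊗ₖ (1 : Matrix κ κ ℂ)) +
        (1 : Matrix (Fin 2) (Fin 2) ℂ) ⊗ₖ H + (J : ℂ) • (pauli .z ⊗ₖ Z))
      (pauli .z ⊗ₖ (1 : Matrix κ κ ℂ)) := by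
  obtain ⟨O, hO, E, h1, hE, hA⟩ := h
  set A := star O * Z * O with hAdef
  have hAH : A.IsHermitian := by
    rw [hAdef, Matrix.star_eq_conjTranspose]
    exact Matrix.isHermitian_conjTranspose_mul_mul O hZ
  obtain ⟨B, hB⟩ : ∃ B : ℝ, ∀ a, |E a| ≤ B := by
    refine ⟨∑ a, |E a|, fun a => Finset.single_le_sum (f := fun a => |E a|) (fun _ _ => abs_nonneg _)
      (Finset.mem_univ a)⟩
  have hEinj : Function.Injective E := fun a b hab => by
    have := hE a a b b (by rw [hab])
    simpa [Sym2.eq_iff] using this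
  -- Sums of two old energies differ by at most `4|B| < 2ω`, so a coincidence of two total energy
  -- sums forces the spin parts and the old parts to coincide separately.
  set ω : ℝ := 4 * |B| + 1 with hω
  have hω0 : 0 < ω := by positivity
  let e : Fin 2 × κ → ℝ := fun q => (if q.1 = 0 then ω else -ω) + E q.2
  have hEb : ∀ a, -|B| ≤ E a ∧ E a ≤ |B| := fun a =>
    abs_le.1 ((hB a).trans (le_abs_self B))
  have he : Function.Injective e := by
    rintro ⟨s, a⟩ ⟨s', b⟩ hab
    have ha := hEb a
    have hb := hEb b
    fin_cases s <;> fin_cases s' <;> simp [e] at hab ⊢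
    · exact hEinj hab
    · linarith
    · linarith
    · exact hEinj hab
  set V := tiltedZ ⊗ₖ A with hVdef
  set W := tiltedZ ⊗ₖ (1 : Matrix κ κ ℂ) with hWdef
  have hherm : ∀ C : Matrix κ κ ℂ, C.IsHermitian → (tiltedZ ⊗ₖ C).IsHermitian := fun C hC => by
    rw [Matrix.IsHermitian, Matrix.conjTranspose_kronecker, hC.eq, tiltedZ_isHermitian.eq]
  have hV := hherm A hAH
  have hW := hherm 1 Matrix.isHermitian_one
  have hV1 : ∀ s a, (V (s, a) (s, a)).re = (if s = 0 then 7 / 25 else -(7 / 25)) * (A a a).re :=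
    fun s a => by
      fin_cases s <;> simp [hVdef, tiltedZ, Complex.mul_re]
  have hW1 : ∀ s a, (W (s, a) (s, a)).re = if s = 0 then 7 / 25 else -(7 / 25) :=
    fun s a => by
      fin_cases s <;> simp [hWdef, tiltedZ]
  -- As `W` acts trivially on the old system, the only intermediate state is the one with the new
  -- qubit flipped and `a` kept; its energy denominator is `±2ω`.
  have hW2 : ∀ s a, (∑ j, W (s, a) j * if j = (s, a) then 0 else
      V j (s, a) / (e (s, a) - e j)).re =
        (24 / 25) ^ 2 / (if s = 0 then 2 * ω else -(2 * ω)) * (A a a).re := fun s a => by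
    have h0 : ∀ s' b, (W (s, a) (s', b) * if (s', b) = (s, a) then 0 else
        V (s', b) (s, a) / (e (s, a) - e (s', b))) =
        if b = a then (if s' = s then 0 else
          (((24 / 25) ^ 2 / (if s = 0 then 2 * ω else -(2 * ω)) : ℝ) : ℂ) * A a a) else 0 := by
      intro s' b
      by_cases hb : b = a
      · subst hb
        fin_cases s <;> fin_cases s' <;> simp [hWdef, hVdef, tiltedZ, e] <;> field_simp <;> ring
      · simp [hWdef, Ne.symm hb, hb]
    rw [Fintype.sum_prod_type, Fin.sum_univ_two]
    simp only [h0, Finset.sum_ite_eq', Finset.mem_univ, if_true]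
    fin_cases s <;> simp only [Fin.zero_eta, Fin.mk_one, if_true, one_ne_zero, zero_ne_one, if_false,
      zero_add, add_zero, Complex.re_ofReal_mul]
  have hev := eventually_isGenericPair he hV hW (fun ⟨s₁, a⟩ ⟨s₂, b⟩ ⟨s₃, c⟩ ⟨s₄, d⟩ h2 h3 => ?_)
    (fun ⟨s, a⟩ ⟨s', b⟩ h2 h3 => ?_)
  · obtain ⟨J, hJ⟩ := hev.exists
    refine ⟨ω * (24 / 25), ω * (7 / 25), J, IsGenericPair.of_conj (S := tilt ⊗ₖ O)
      (Matrix.kronecker_mem_unitary ?_ hO) ?_⟩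
    · rw [Matrix.mem_unitaryGroup_iff, star_tilt, tilt_mul_tilt]
    · have hOO : star O * O = 1 := Matrix.mem_unitaryGroup_iff'.1 hO
      have hS : star (tilt ⊗ₖ O) = tilt ⊗ₖ star O := by
        rw [Matrix.star_eq_conjTranspose, Matrix.conjTranspose_kronecker,
          ← Matrix.star_eq_conjTranspose, star_tilt, Matrix.star_eq_conjTranspose]
      have hconj : ∀ (P : Matrix (Fin 2) (Fin 2) ℂ) (Q : Matrix κ κ ℂ),
          star (tilt ⊗ₖ O) * (P ⊗ₖ Q) * (tilt ⊗ₖ O) = (tilt * P * tilt) ⊗ₖ (star O * Q * O) :=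
        fun P Q => by rw [hS, ← Matrix.mul_kronecker_mul, ← Matrix.mul_kronecker_mul]
      rw [hconj, tilt_mul_pauli_z_mul_tilt, mul_one, hOO]
      convert hJ using 1
      have hdiag : Matrix.diagonal (fun j => (e j : ℂ)) =
          (ω : ℂ) • (pauli .z ⊗ₖ (1 : Matrix κ κ ℂ)) + (1 : Matrix (Fin 2) (Fin 2) ℂ) ⊗ₖ
            Matrix.diagonal fun j => (E j : ℂ) := by
        ext ⟨s, a⟩ ⟨s', b⟩
        by_cases hb : a = b
        · subst hb
          fin_cases s <;> fin_cases s' <;> simp [e, pauli]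
        · simp [hb, Prod.ext_iff]
      have hfield : (((ω * (24 / 25) : ℝ) : ℂ) • (pauli .x ⊗ₖ (1 : Matrix κ κ ℂ)) +
          ((ω * (7 / 25) : ℝ) : ℂ) • (pauli .z ⊗ₖ (1 : Matrix κ κ ℂ))) =
          (ω : ℂ) • (((24 / 25 : ℂ) • pauli .x + (7 / 25 : ℂ) • pauli .z) ⊗ₖ
            (1 : Matrix κ κ ℂ)) := by
        rw [Matrix.add_kronecker, Matrix.smul_kronecker, Matrix.smul_kronecker, smul_add, smul_smul,
          smul_smul]
        push_cast
        rfl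
      rw [hfield, hdiag, mul_add, mul_add, add_mul, add_mul, mul_smul_comm, mul_smul_comm,
        smul_mul_assoc, smul_mul_assoc, hconj, hconj, hconj, tilt_mul_tiltedZ_mul_tilt,
        tilt_mul_pauli_z_mul_tilt, mul_one, mul_one, tilt_mul_tilt, mul_assoc (star O) H, h1,
        ← mul_assoc, hOO, one_mul]
  -- The spins and the old labels agree as unordered pairs. The only ambiguity left is between `(↑a,
  -- ↓b)` and `(↑b, ↓a)`, whose first-order shifts are `±(7/25)(A a a - A b b)`.
  · have ha := hEb a
    have hb := hEb b
    have hc := hEb c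
    have hd := hEb d
    have hsum : E a + E b = E c + E d ∧
        ((s₁ = s₃ ∧ s₂ = s₄) ∨ (s₁ = s₄ ∧ s₂ = s₃)) := by
      fin_cases s₁ <;> fin_cases s₂ <;> fin_cases s₃ <;> fin_cases s₄ <;> simp [e] at h2 ⊢ <;>
        linarith
    have hE' := hE a b c d hsum.1
    rw [hV1, hV1, hV1, hV1] at h3
    have key : ∀ x y : κ, ∀ s s' : Fin 2, s ≠ s' →
        (if s = 0 then 7 / 25 else -(7 / 25) : ℝ) * (A x x).re +
          (if s' = 0 then 7 / 25 else -(7 / 25)) * (A y y).re =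
        (if s = 0 then 7 / 25 else -(7 / 25)) * (A y y).re +
          (if s' = 0 then 7 / 25 else -(7 / 25)) * (A x x).re → x = y := by
      intro x y s s' hss h
      refine hA ?_
      fin_cases s <;> fin_cases s' <;> simp at hss h ⊢ <;> linarith
    rw [Sym2.eq_iff] at hE' ⊢
    simp only [Prod.mk.injEq]
    by_cases h12 : s₁ = s₂
    · subst h12
      rcases hsum.2 with ⟨rfl, rfl⟩ | ⟨rfl, rfl⟩ <;> tauto
    · rcases hsum.2 with ⟨rfl, rfl⟩ | ⟨rfl, rfl⟩ <;> rcases hE' with ⟨rfl, rfl⟩ | ⟨rfl, rfl⟩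
      · tauto
      · have := key a b _ _ h12 h3
        subst this; tauto
      · have := key a b _ _ h12 (by linarith)
        subst this; tauto
      · tauto
  -- At zeroth order `W` distinguishes the state of the new qubit; the first-order term, a nonzero
  -- multiple of `A a a`, distinguishes `a`.
  · rw [hW1, hW1] at h2
    rw [hW2, hW2] at h3
    obtain rfl : s = s' := by
      fin_cases s <;> fin_cases s' <;> simp at h2 ⊢ <;> norm_num at h2
    rw [Prod.mk.injEq]
    refine ⟨rfl, hA (mul_left_cancel₀ ?_ h3)⟩
    have := hω0.ne'
    split_ifs <;> simp [this]

/-! ## The Ising chain in tilted fields -/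

lemma pauli_isHermitian (u : Axis) : (pauli u).IsHermitian := by
  cases u <;> ext i j <;> fin_cases i <;> fin_cases j <;> simp [pauli]

lemma pauliAt_isHermitian {N : ℕ} (l : Fin N) (u : Axis) : (pauliAt l u).IsHermitian := by
  refine Matrix.IsHermitian.ext fun s s' => ?_
  rw [pauliAt, pauliAt, star_prod]
  refine Finset.prod_congr rfl fun k _ => ?_
  split_ifs
  · exact (pauli_isHermitian u).apply _ _
  · exact Matrix.isHermitian_one.apply _ _

/-- Splitting off the first qubit. -/
def splitFirst (N : ℕ) : Config (N + 1) ≃ Fin 2 × Config N :=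
  (Fin.consEquiv fun _ => Fin 2).symm

lemma one_apply_eq_prod {N : ℕ} (s s' : Config N) :
    (1 : Operator N) s s' = ∏ k, (1 : Matrix (Fin 2) (Fin 2) ℂ) (s k) (s' k) := by
  simp only [Matrix.one_apply, funext_iff, Finset.prod_ite_zero, Finset.mem_univ, true_imp_iff,
    Finset.prod_const_one]

open scoped Kronecker in
lemma pauliAt_zero {N : ℕ} (u : Axis) :
    pauliAt (0 : Fin (N + 1)) u =
      (pauli u ⊗ₖ (1 : Operator N)).submatrix (splitFirst N) (splitFirst N) := by
  ext s s'
  rw [pauliAt, Fin.prod_univ_succ, Matrix.submatrix_apply, Matrix.kroneckerMap_apply,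
    one_apply_eq_prod]
  simp only [if_true, Fin.succ_ne_zero, if_false]
  rfl

open scoped Kronecker in
lemma pauliAt_succ {N : ℕ} (l : Fin N) (u : Axis) :
    pauliAt l.succ u =
      ((1 : Matrix (Fin 2) (Fin 2) ℂ) ⊗ₖ pauliAt l u).submatrix (splitFirst N) (splitFirst N) := by
  ext s s'
  rw [pauliAt, Fin.prod_univ_succ, Matrix.submatrix_apply, Matrix.kroneckerMap_apply, pauliAt]
  simp only [(Fin.succ_ne_zero l).symm, if_false, Fin.succ_inj]
  rfl

/-- The Ising chain of `N` qubits with transverse fields `f`, longitudinal fields `g` and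
couplings `J`. -/
noncomputable def isingChain {N : ℕ} (f g : Fin N → ℝ) (J : Fin (N - 1) → ℝ) : Operator N :=
  ∑ l, (f l : ℂ) • pauliAt l .x + ∑ l, (g l : ℂ) • pauliAt l .z +
    ∑ l, (J l : ℂ) • (pauliAt (bondLeft l) .z * pauliAt (bondRight l) .z)

/-- For suitable fields and couplings the Ising chain has nondegenerate gaps. -/
theorem exists_isGenericPair_isingChain (N : ℕ) :
    ∃ (f g : Fin (N + 1) → ℝ) (J : Fin (N + 1 - 1) → ℝ),
      IsGenericPair (isingChain f g J) (pauliAt 0 .z) := by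
  induction N with
  | zero =>
    -- With no qubits the space is one-dimensional and genericity is vacuous; attaching a qubit to
    -- it gives the one-qubit chain.
    have h0 : IsGenericPair (0 : Operator 0) 0 :=
      ⟨1, one_mem _, 0, by simp, fun a b c d _ => by
        rw [Subsingleton.elim a c, Subsingleton.elim b d], Function.injective_of_subsingleton _⟩
    obtain ⟨f, g, J, h⟩ := h0.exists_coupling Matrix.isHermitian_zero
    refine ⟨fun _ => f, fun _ => g, fun _ => 0, ?_⟩
    have h' := h.submatrix (splitFirst 0)
    rw [← pauliAt_zero] at h'
    convert h' using 1
    simp [isingChain, Matrix.submatrix_add, Matrix.submatrix_smul, pauliAt_zero]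
  | succ N ih =>
    obtain ⟨f, g, J, h⟩ := ih
    obtain ⟨f₀, g₀, J₀, h⟩ := h.exists_coupling (pauliAt_isHermitian 0 .z)
    refine ⟨Fin.cons f₀ f, Fin.cons g₀ g, (Fin.cons J₀ J : Fin (N + 1) → ℝ), ?_⟩
    have h' := h.submatrix (splitFirst (N + 1))
    rw [← pauliAt_zero] at h'
    convert h' using 1
    have hb0 : pauliAt (bondLeft (N := N + 2) (0 : Fin (N + 1))) .z *
        pauliAt (bondRight (N := N + 2) (0 : Fin (N + 1))) .z =
        (Matrix.kroneckerMap (· * ·) (pauli .z) (pauliAt (0 : Fin (N + 1)) .z)).submatrix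
          (splitFirst (N + 1)) (splitFirst (N + 1)) := by
      change pauliAt 0 .z * pauliAt (Fin.succ 0) .z = _
      rw [pauliAt_zero, pauliAt_succ, Matrix.submatrix_mul_equiv, ← Matrix.mul_kronecker_mul,
        mul_one, one_mul]
    have hb : ∀ l : Fin N, pauliAt (bondLeft (N := N + 2) l.succ) .z *
        pauliAt (bondRight (N := N + 2) l.succ) .z =
        (Matrix.kroneckerMap (· * ·) (1 : Matrix (Fin 2) (Fin 2) ℂ)
          (pauliAt (bondLeft (N := N + 1) l) .z * pauliAt (bondRight (N := N + 1) l) .z)).submatrix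
          (splitFirst (N + 1)) (splitFirst (N + 1)) := fun l => by
      change pauliAt (Fin.succ (bondLeft (N := N + 1) l)) .z *
        pauliAt (Fin.succ (bondRight (N := N + 1) l)) .z = _
      rw [pauliAt_succ, pauliAt_succ, Matrix.submatrix_mul_equiv, ← Matrix.mul_kronecker_mul,
        one_mul]
    have hJ : ∀ F : Fin (N + 1 + 1 - 1) → Operator (N + 2),
        ∑ l, F l = F (0 : Fin (N + 1)) + ∑ l : Fin N, F (Fin.succ l : Fin (N + 1)) :=
      fun F => Fin.sum_univ_succ (n := N) F
    rw [isingChain, hJ, Fin.sum_univ_succ (n := N + 1), Fin.sum_univ_succ (n := N + 1), hb0]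
    simp only [hb, Fin.cons_zero, Fin.cons_succ, pauliAt_zero, pauliAt_succ]
    ext s s'
    simp only [isingChain, Matrix.add_apply, Matrix.smul_apply, Matrix.sum_apply,
      Matrix.submatrix_apply, Matrix.kroneckerMap_apply, smul_eq_mul, mul_add, Finset.mul_sum,
      mul_left_comm _ ((1 : Matrix (Fin 2) (Fin 2) ℂ) _ _)]
    change _ = _ + (_ + _ + ∑ l : Fin N, _) + _
    ring

/-! ## Nondegenerate gaps of unitary matrices -/

/-- Off-diagonal pairs arise from two orderings, diagonal ones from one ordering and the extra sum.
Applied to power sums, this is the trace formula for the symmetric square. -/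
lemma two_mul_sum_sym2 {κ R : Type*} [Fintype κ] [DecidableEq κ] [CommRing R] (F : Sym2 κ → R) :
    2 * ∑ s, F s = ∑ a, ∑ b, F s(a, b) + ∑ a, F s(a, a) := by
  have h1 : ∀ s : Sym2 κ, ((Finset.univ.filter fun p : κ × κ => s(p.1, p.2) = s).card +
      (Finset.univ.filter fun a : κ => s(a, a) = s).card) = 2 := by
    intro s
    induction s with | _ a b
    by_cases hab : a = b
    · subst hab
      have e1 : (Finset.univ.filter fun p : κ × κ => s(p.1, p.2) = s(a, a)) = {(a, a)} := by
        ext ⟨x, y⟩; simp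
      have e2 : (Finset.univ.filter fun x : κ => s(x, x) = s(a, a)) = {a} := by
        ext x; simp
      rw [e1, e2]; rfl
    · have e1 : (Finset.univ.filter fun p : κ × κ => s(p.1, p.2) = s(a, b)) = {(a, b), (b, a)} := by
        ext ⟨x, y⟩; simp
      have e2 : (Finset.univ.filter fun x : κ => s(x, x) = s(a, b)) = ∅ := by
        ext x
        simp only [Finset.mem_filter, Finset.mem_univ, true_and, Sym2.eq_iff, Finset.notMem_empty,
          iff_false]
        rintro (⟨rfl, h⟩ | ⟨rfl, h⟩)
        · exact hab h
        · exact hab h.symm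
      rw [e1, e2, Finset.card_pair (by simp [hab])]; rfl
  have h2 : ∑ a, ∑ b, F s(a, b) =
      ∑ s, ((Finset.univ.filter fun p : κ × κ => s(p.1, p.2) = s).card : R) * F s := by
    rw [← Fintype.sum_prod_type' (f := fun a b => F s(a, b)),
      ← Finset.sum_fiberwise (s := Finset.univ) (g := fun p : κ × κ => s(p.1, p.2))]
    refine Finset.sum_congr rfl fun s _ => ?_
    rw [Finset.sum_congr rfl (g := fun _ => F s) fun p hp => by rw [(Finset.mem_filter.1 hp).2],
      Finset.sum_const, nsmul_eq_mul]
  have h3 : ∑ a, F s(a, a) =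
      ∑ s, ((Finset.univ.filter fun a : κ => s(a, a) = s).card : R) * F s := by
    rw [← Finset.sum_fiberwise (s := Finset.univ) (g := fun a : κ => s(a, a))]
    refine Finset.sum_congr rfl fun s _ => ?_
    rw [Finset.sum_congr rfl (g := fun _ => F s) fun p hp => by rw [(Finset.mem_filter.1 hp).2],
      Finset.sum_const, nsmul_eq_mul]
  rw [h2, h3, ← Finset.sum_add_distrib, Finset.mul_sum]
  refine Finset.sum_congr rfl fun s _ => ?_
  rw [← add_mul, ← Nat.cast_add, h1, Nat.cast_two]

/-- The discriminant of the products `z a * z b`, over unordered pairs, of the eigenvalues `z` of a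
matrix, as a Hankel determinant of power sums. -/
noncomputable def gapDiscriminant {κ : Type*} [Fintype κ] [DecidableEq κ] (U : Matrix κ κ ℂ) : ℂ :=
  Matrix.det (Matrix.of fun i j : Fin (Fintype.card (Sym2 κ)) =>
    ((U ^ (i + j : ℕ)).trace ^ 2 + (U ^ (2 * (i + j : ℕ))).trace) / 2)

lemma trace_pow_of_diagonalization {κ : Type*} [Fintype κ] [DecidableEq κ] {U O : Matrix κ κ ℂ}
    (hO : O ∈ Matrix.unitaryGroup κ ℂ) {z : κ → ℂ} (h : U * O = O * Matrix.diagonal z) (m : ℕ) :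
    (U ^ m).trace = ∑ a, z a ^ m := by
  have h1 : U ^ m * O = O * Matrix.diagonal z ^ m := by
    have : SemiconjBy O (Matrix.diagonal z) U := h.symm
    exact (this.pow_right m).symm
  have h2 : U ^ m = O * Matrix.diagonal z ^ m * star O := by
    rw [← h1, mul_assoc, Matrix.mem_unitaryGroup_iff.1 hO, mul_one]
  rw [h2, Matrix.trace_mul_comm, ← mul_assoc, Matrix.mem_unitaryGroup_iff'.1 hO, one_mul,
    Matrix.diagonal_pow, Matrix.trace_diagonal]
  rfl

theorem gapDiscriminant_ne_zero_iff {κ : Type*} [Fintype κ] [DecidableEq κ] {U O : Matrix κ κ ℂ}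
    (hO : O ∈ Matrix.unitaryGroup κ ℂ) {z : κ → ℂ} (h : U * O = O * Matrix.diagonal z) :
    gapDiscriminant U ≠ 0 ↔ ∀ a b c d, z a * z b = z c * z d → s(a, b) = s(c, d) := by
  let y : Sym2 κ → ℂ := fun s => (s.map z).mul
  let σ := (Fintype.equivFin (Sym2 κ)).symm
  have hp : ∀ m : ℕ, ((U ^ m).trace ^ 2 + (U ^ (2 * m)).trace) / 2 = ∑ s, y s ^ m := fun m => by
    rw [div_eq_iff two_ne_zero, mul_comm _ (2 : ℂ), two_mul_sum_sym2, trace_pow_of_diagonalization hO h,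
      trace_pow_of_diagonalization hO h, sq, Finset.sum_mul_sum]
    simp [y, mul_pow, pow_mul, sq]
  -- The Hankel matrix of power sums is `Vᵀ V` with `V` the Vandermonde matrix of the products, so
  -- its determinant vanishes exactly when two products coincide.
  have hdet : gapDiscriminant U =
      ((Matrix.vandermonde fun i => y (σ i)).transpose * Matrix.vandermonde fun i => y (σ i)).det := by
    rw [gapDiscriminant]
    congr 1
    ext i j
    rw [Matrix.of_apply, hp, Matrix.vandermonde_transpose_mul_vandermonde, ← σ.sum_comp]
  rw [hdet, Matrix.det_mul, Matrix.det_transpose, mul_self_ne_zero,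
    Matrix.det_vandermonde_ne_zero_iff]
  change Function.Injective (y ∘ σ) ↔ _
  rw [σ.injective_comp]
  constructor
  · intro hi a b c d h
    exact hi h
  · intro hi s t
    induction s with | _ a b
    induction t with | _ c d
    exact hi a b c d

/-- Unitary matrices are unitarily diagonalizable (by the Cayley transform). -/
theorem exists_unitary_diagonalization {κ : Type*} [Fintype κ] [DecidableEq κ] {U : Matrix κ κ ℂ}
    (hU : U ∈ Matrix.unitaryGroup κ ℂ) :
    ∃ O ∈ Matrix.unitaryGroup κ ℂ, ∃ z : κ → ℂ, (∀ a, ‖z a‖ = 1) ∧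
      U * O = O * Matrix.diagonal z := by
  -- The unit circle is infinite, so it contains a point `ξ` that is not an eigenvalue. The Cayley
  -- transform `H = i (ξ + U) (ξ - U)⁻¹` is then defined and Hermitian.
  obtain ⟨ξ, hξ, hdet⟩ : ∃ ξ : ℂ, ‖ξ‖ = 1 ∧ (ξ • (1 : Matrix κ κ ℂ) - U).det ≠ 0 := by
    have hinf : (Metric.sphere (0 : ℂ) 1).Infinite := by
      refine (isPreconnected_sphere (by simp [Complex.rank_real_complex]) 0 1).infinite_of_nontrivial
        ⟨1, by simp, -1, by simp, ?_⟩
      norm_num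
    obtain ⟨ξ, h1, h2⟩ := (hinf.sdiff (U.charpoly.roots.toFinset.finite_toSet)).nonempty
    refine ⟨ξ, by simpa using h1, fun h => h2 ?_⟩
    rw [Matrix.smul_one_eq_diagonal, ← Matrix.scalar_apply, ← Matrix.eval_charpoly] at h
    simpa [U.charpoly_monic.ne_zero] using h
  have hξ' : star ξ * ξ = 1 := by
    rw [mul_comm, RCLike.star_def, Complex.mul_conj']; simp [hξ]
  have hUU : U * star U = 1 := Matrix.mem_unitaryGroup_iff.1 hU
  set M := ξ • (1 : Matrix κ κ ℂ) - U with hM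
  have hMu : IsUnit M.det := isUnit_iff_ne_zero.2 hdet
  set P := ξ • (1 : Matrix κ κ ℂ) + U with hP
  have hPM : M * P = P * M := by
    simp only [hP, hM, mul_sub, sub_mul, mul_add, add_mul, smul_mul_assoc, mul_smul_comm, one_mul,
      mul_one]
    module
  set H := Complex.I • (P * M⁻¹) with hH
  have hHM : H * M = Complex.I • P := by
    rw [hH, smul_mul_assoc, mul_assoc, Matrix.nonsing_inv_mul _ hMu, mul_one]
  have hMH : M * H = Complex.I • P := by
    rw [hH, mul_smul_comm, ← mul_assoc, hPM, mul_assoc, Matrix.mul_nonsing_inv _ hMu, mul_one]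
  have hHH : H.IsHermitian := by
    have e1 : U * star M = -(star ξ • M) := by
      simp only [hM, star_sub, star_smul, star_one, mul_sub, mul_smul_comm, mul_one, hUU, smul_sub,
        smul_smul, hξ', one_smul]
      abel
    have e2 : U * star P = star ξ • P := by
      simp only [hP, star_add, star_smul, star_one, mul_add, mul_smul_comm, mul_one, hUU, smul_add,
        smul_smul, hξ', one_smul]
      abel
    have e3 : star M * star H = -Complex.I • star P := by
      rw [← star_mul, hHM, star_smul]; simp
    have e4 : star ξ • (M * star H) = star ξ • (Complex.I • P) := by
      have := congrArg (fun X => U * X) e3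
      simp only [← mul_assoc, e1, mul_smul_comm, e2] at this
      rw [neg_mul, smul_mul_assoc, neg_smul, neg_inj] at this
      rw [this, smul_comm]
    have hξ0 : star ξ ≠ 0 := left_ne_zero_of_mul_eq_one hξ'
    have e5 : M * star H = M * H := (smul_right_injective _ hξ0 e4).trans hMH.symm
    have e6 := congrArg (fun X => M⁻¹ * X) e5
    simp only [← mul_assoc, Matrix.nonsing_inv_mul _ hMu, one_mul] at e6
    exact e6
  obtain ⟨O, hO, E, hE⟩ : ∃ O ∈ Matrix.unitaryGroup κ ℂ, ∃ E : κ → ℝ,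
      H * O = O * Matrix.diagonal fun a => (E a : ℂ) := by
    refine ⟨hHH.eigenvectorUnitary, hHH.eigenvectorUnitary.2, hHH.eigenvalues, ?_⟩
    have h1 := hHH.conjStarAlgAut_star_eigenvectorUnitary
    rw [Unitary.conjStarAlgAut_star_apply] at h1
    have h2 := congrArg (fun X => (hHH.eigenvectorUnitary : Matrix κ κ ℂ) * X) h1
    simp only [← mul_assoc] at h2
    rw [Matrix.mem_unitaryGroup_iff.1 hHH.eigenvectorUnitary.2, one_mul] at h2
    exact h2
  have hEi : ∀ a, (E a : ℂ) + Complex.I ≠ 0 := fun a h => by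
    simpa using congrArg Complex.im h
  refine ⟨O, hO, fun a => ξ * ((E a - Complex.I) / (E a + Complex.I)), fun a => ?_, ?_⟩
  · have h1 : (E a : ℂ) - Complex.I = star ((E a : ℂ) + Complex.I) := by simp [sub_eq_add_neg]
    rw [norm_mul, hξ, one_mul, norm_div, h1, norm_star, div_self (norm_ne_zero_iff.2 (hEi a))]
  -- Inverting the Cayley transform: `U (H + i) = ξ (H - i)`, so an eigenbasis of `H` diagonalises
  -- `U`.
  · have h1 : U * H + Complex.I • U = ξ • H - (Complex.I * ξ) • 1 := by
      have h2 := hMH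
      rw [hM, sub_mul, smul_mul_assoc, one_mul, hP] at h2
      linear_combination (norm := module) -h2
    have h3 := congrArg (fun X => X * O) h1
    simp only [add_mul, sub_mul, smul_mul_assoc, mul_assoc, one_mul, hE] at h3
    rw [← mul_assoc] at h3
    ext j a
    have h4 := congrFun (congrFun h3 j) a
    simp only [Matrix.add_apply, Matrix.sub_apply, Matrix.smul_apply, Matrix.mul_diagonal,
      smul_eq_mul] at h4
    rw [Matrix.mul_diagonal, mul_div_assoc', mul_div_assoc', eq_div_iff (hEi a)]
    linear_combination h4

/-! ## Moments of Haar-random product states -/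

-- A linear equivalence rescales volume by a constant, which is `1` because an isometry preserves
-- the unit ball. The sphere measure is defined by volumes of cones, and `g` maps cones to cones.
open scoped Pointwise in
lemma measurePreserving_haarQubit
    (g : EuclideanSpace ℂ (Fin 2) ≃ₗᵢ[ℝ] EuclideanSpace ℂ (Fin 2)) :
    MeasurePreserving (fun φ : Metric.sphere (0 : EuclideanSpace ℂ (Fin 2)) 1 =>
      (⟨g φ.1, by simp⟩ : Metric.sphere (0 : EuclideanSpace ℂ (Fin 2)) 1)) haarQubit haarQubit := by
  set G := fun φ : Metric.sphere (0 : EuclideanSpace ℂ (Fin 2)) 1 =>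
      (⟨g φ.1, by simp⟩ : Metric.sphere (0 : EuclideanSpace ℂ (Fin 2)) 1) with hG
  have hGm : Measurable G := by
    refine Continuous.measurable ?_
    exact Continuous.subtype_mk (g.continuous.comp continuous_subtype_val) _
  have hvol : ∀ s : Set (EuclideanSpace ℂ (Fin 2)), volume (g ⁻¹' s) = volume s := fun s => by
    have h := Measure.addHaar_preimage_linearEquiv
      (volume : Measure (EuclideanSpace ℂ (Fin 2))) g.toLinearEquiv
    have h1 := h (Metric.ball 0 1)
    have h2 : g.toLinearEquiv ⁻¹' Metric.ball 0 1 = Metric.ball 0 1 := by ext; simp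
    rw [h2] at h1
    have h3 := h s
    have hc : ENNReal.ofReal |LinearMap.det (g.toLinearEquiv.symm : EuclideanSpace ℂ (Fin 2) →ₗ[ℝ]
        EuclideanSpace ℂ (Fin 2))| = 1 := by
      have hb := (Metric.measure_ball_pos (volume : Measure (EuclideanSpace ℂ (Fin 2))) 0 one_pos).ne'
      have ht : volume (Metric.ball (0 : EuclideanSpace ℂ (Fin 2)) 1) ≠ ⊤ := measure_ball_lt_top.ne
      exact (ENNReal.mul_eq_right hb ht).1 h1.symm
    rw [hc, one_mul] at h3
    exact h3
  refine ⟨hGm, Measure.ext fun s hs => ?_⟩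
  rw [Measure.map_apply hGm hs, haarQubit, Measure.smul_apply, Measure.smul_apply,
    Measure.toSphere_apply' _ (hGm hs), Measure.toSphere_apply' _ hs]
  congr 2
  rw [← hvol (Set.Ioo (0 : ℝ) 1 • (Subtype.val '' s))]
  congr 1
  ext v
  simp only [Set.mem_smul, Set.mem_image, Set.mem_preimage, Subtype.exists, exists_and_right,
    exists_eq_right]
  constructor
  · rintro ⟨r, hr, w, ⟨hw, hws⟩, rfl⟩
    exact ⟨r, hr, g w, ⟨by simpa using hw, hws⟩, by simp⟩
  · rintro ⟨r, hr, w, ⟨hw, hws⟩, hv⟩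
    refine ⟨r, hr, g.symm w, ⟨by simpa using hw, ?_⟩, ?_⟩
    · convert hws
      simp
    · apply g.injective
      rw [map_smul, g.apply_symm_apply, hv]

lemma integral_haarQubit_comp
    (g : EuclideanSpace ℂ (Fin 2) →ₗᵢ[ℝ] EuclideanSpace ℂ (Fin 2))
    {F : EuclideanSpace ℂ (Fin 2) → ℝ} (hF : Continuous F) :
    ∫ φ, F (g φ.1) ∂haarQubit = ∫ φ, F φ.1 ∂haarQubit := by
  have h := measurePreserving_haarQubit (g.toLinearIsometryEquiv rfl)
  have h1 := integral_map (μ := haarQubit) (f := fun φ => F φ.1) h.measurable.aemeasurable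
    (hF.comp continuous_subtype_val).aestronglyMeasurable
  rw [h.map_eq] at h1
  exact h1.symm

lemma integrable_haarQubit {F : EuclideanSpace ℂ (Fin 2) → ℝ} (hF : Continuous F) :
    Integrable (fun φ : Metric.sphere (0 : EuclideanSpace ℂ (Fin 2)) 1 => F φ.1) haarQubit :=
  (hF.comp continuous_subtype_val).integrable_of_hasCompactSupport
    (HasCompactSupport.of_compactSpace _)

lemma normSq_add_normSq_of_mem_sphere (φ : Metric.sphere (0 : EuclideanSpace ℂ (Fin 2)) 1) :
    ‖φ.1 0‖ ^ 2 + ‖φ.1 1‖ ^ 2 = 1 := by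
  have h : ‖φ.1‖ = 1 := by simp
  rw [EuclideanSpace.norm_eq, Real.sqrt_eq_one, Fin.sum_univ_two] at h
  exact h

/-- A relative phase between the two amplitudes. -/
noncomputable def phaseIsometry {ζ : ℂ} (hζ : ‖ζ‖ = 1) :
    EuclideanSpace ℂ (Fin 2) →ₗᵢ[ℝ] EuclideanSpace ℂ (Fin 2) where
  toFun v := !₂[v 0, ζ * v 1]
  map_add' v w := by ext i; fin_cases i <;> simp [mul_add]
  map_smul' c v := by ext i; fin_cases i <;> simp [mul_left_comm]
  norm_map' v := by
    change ‖(!₂[v 0, ζ * v 1] : EuclideanSpace ℂ (Fin 2))‖ = ‖v‖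
    simp [EuclideanSpace.norm_eq, hζ]

lemma norm_add_sq_add_norm_sub_sq (x y : ℂ) : ‖x + y‖ ^ 2 + ‖x - y‖ ^ 2 = 2 * (‖x‖ ^ 2 + ‖y‖ ^ 2) := by
  have := parallelogram_law_with_norm ℝ x y
  simp only [sq]
  linarith

/-- The Hadamard gate. -/
noncomputable def hadamardIsometry :
    EuclideanSpace ℂ (Fin 2) →ₗᵢ[ℝ] EuclideanSpace ℂ (Fin 2) where
  toFun v := !₂[((√2 : ℝ) : ℂ)⁻¹ * (v 0 + v 1), ((√2 : ℝ) : ℂ)⁻¹ * (v 0 - v 1)]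
  map_add' v w := by ext i; fin_cases i <;> simp <;> ring
  map_smul' c v := by ext i; fin_cases i <;> simp <;> ring
  norm_map' v := by
    change ‖(!₂[((√2 : ℝ) : ℂ)⁻¹ * (v 0 + v 1), ((√2 : ℝ) : ℂ)⁻¹ * (v 0 - v 1)] :
      EuclideanSpace ℂ (Fin 2))‖ = ‖v‖
    have := norm_add_sq_add_norm_sub_sq (v 0) (v 1)
    simp only [EuclideanSpace.norm_eq, Fin.sum_univ_two]
    congr 1
    simp [mul_pow]
    linarith

/-- Exchange of the two amplitudes. -/
noncomputable def swapIsometry :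
    EuclideanSpace ℂ (Fin 2) →ₗᵢ[ℝ] EuclideanSpace ℂ (Fin 2) where
  toFun v := !₂[v 1, v 0]
  map_add' v w := by ext i; fin_cases i <;> simp
  map_smul' c v := by ext i; fin_cases i <;> simp
  norm_map' v := by
    change ‖(!₂[v 1, v 0] : EuclideanSpace ℂ (Fin 2))‖ = ‖v‖
    simp [EuclideanSpace.norm_eq, add_comm]

/-- Averaging over relative phases. -/
lemma integral_haarQubit_phase {F : EuclideanSpace ℂ (Fin 2) → ℝ} (hF : Continuous F) :
    4 * ∫ φ, F φ.1 ∂haarQubit = ∫ φ, (F φ.1 + F (!₂[φ.1 0, Complex.I * φ.1 1]) +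
      F (!₂[φ.1 0, -1 * φ.1 1]) + F (!₂[φ.1 0, -Complex.I * φ.1 1])) ∂haarQubit := by
  have h : ∀ {ζ : ℂ} (hζ : ‖ζ‖ = 1), ∫ φ, F (!₂[φ.1 0, ζ * φ.1 1]) ∂haarQubit =
      ∫ φ, F φ.1 ∂haarQubit := fun hζ => integral_haarQubit_comp (phaseIsometry hζ) hF
  have hi : ∀ {ζ : ℂ} (hζ : ‖ζ‖ = 1), Integrable (fun φ :
      Metric.sphere (0 : EuclideanSpace ℂ (Fin 2)) 1 => F (!₂[φ.1 0, ζ * φ.1 1])) haarQubit :=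
    fun hζ => integrable_haarQubit (hF.comp (phaseIsometry hζ).continuous)
  have hi0 := integrable_haarQubit hF
  have n1 : ‖(-1 : ℂ)‖ = 1 := by simp
  have n2 : ‖-Complex.I‖ = 1 := by simp
  rw [integral_add ((hi0.fun_add (hi Complex.norm_I)).fun_add (hi n1)) (hi n2),
    integral_add (hi0.fun_add (hi Complex.norm_I)) (hi n1), integral_add hi0 (hi Complex.norm_I),
    h Complex.norm_I, h n1, h n2]
  ring

lemma norm_add_sq_eq (x y : ℂ) :
    ‖x + y‖ ^ 2 = ‖x‖ ^ 2 + ‖y‖ ^ 2 + 2 * (star x * y).re := by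
  simp only [Complex.sq_norm, Complex.normSq_apply, Complex.add_re, Complex.add_im, Complex.mul_re,
    RCLike.star_def, Complex.conj_re, Complex.conj_im]
  ring

/-- Three symmetries determine the moment. Swap invariance and normalisation give `∫ |φ₀|² = 1/2`.
Hadamard invariance, averaged over relative phases, gives `4 m = 1 + 2 ∫ |φ₀|² - 2 m`, where `m` is
the fourth moment. -/
lemma integral_haarQubit_norm_pow_four : ∫ φ, ‖φ.1 0‖ ^ 4 ∂haarQubit = 1 / 3 := by
  have hc0 : Continuous fun v : EuclideanSpace ℂ (Fin 2) => ‖v 0‖ ^ 4 := by fun_prop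
  have hc2 : Continuous fun v : EuclideanSpace ℂ (Fin 2) => ‖v 0‖ ^ 2 := by fun_prop
  have hswap : ∫ φ, ‖φ.1 1‖ ^ 4 ∂haarQubit = ∫ φ, ‖φ.1 0‖ ^ 4 ∂haarQubit :=
    integral_haarQubit_comp swapIsometry hc0
  have h1 : ∫ φ, ‖φ.1 1‖ ^ 4 ∂haarQubit =
      1 - 2 * ∫ φ, ‖φ.1 0‖ ^ 2 ∂haarQubit + ∫ φ, ‖φ.1 0‖ ^ 4 ∂haarQubit := by
    have e : ∀ φ : Metric.sphere (0 : EuclideanSpace ℂ (Fin 2)) 1,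
        ‖φ.1 1‖ ^ 4 = 1 - 2 * ‖φ.1 0‖ ^ 2 + ‖φ.1 0‖ ^ 4 := fun φ => by
      have := normSq_add_normSq_of_mem_sphere φ
      have h : ‖φ.1 1‖ ^ 2 = 1 - ‖φ.1 0‖ ^ 2 := by linarith
      calc ‖φ.1 1‖ ^ 4 = (‖φ.1 1‖ ^ 2) ^ 2 := by ring
        _ = _ := by rw [h]; ring
    simp_rw [e]
    rw [integral_add (integrable_haarQubit (F := fun v => 1 - 2 * ‖v 0‖ ^ 2) (by fun_prop))
      (integrable_haarQubit hc0), integral_sub (integrable_const _)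
      ((integrable_haarQubit hc2).const_mul 2), integral_const_mul]
    simp
  have h2 : ∫ φ, ‖φ.1 0‖ ^ 4 ∂haarQubit =
      ∫ φ, ‖((√2 : ℝ) : ℂ)⁻¹ * (φ.1 0 + φ.1 1)‖ ^ 4 ∂haarQubit :=
    (integral_haarQubit_comp hadamardIsometry hc0).symm
  have h3 := integral_haarQubit_phase
    (F := fun v => ‖((√2 : ℝ) : ℂ)⁻¹ * (v 0 + v 1)‖ ^ 4) (by fun_prop)
  have e : ∀ φ : Metric.sphere (0 : EuclideanSpace ℂ (Fin 2)) 1,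
      (‖((√2 : ℝ) : ℂ)⁻¹ * (φ.1 0 + φ.1 1)‖ ^ 4 +
        ‖((√2 : ℝ) : ℂ)⁻¹ * (φ.1 0 + Complex.I * φ.1 1)‖ ^ 4 +
        ‖((√2 : ℝ) : ℂ)⁻¹ * (φ.1 0 + -1 * φ.1 1)‖ ^ 4 +
        ‖((√2 : ℝ) : ℂ)⁻¹ * (φ.1 0 + -Complex.I * φ.1 1)‖ ^ 4) =
      1 + 2 * ‖φ.1 0‖ ^ 2 - 2 * ‖φ.1 0‖ ^ 4 := fun φ => by
    have h := normSq_add_normSq_of_mem_sphere φ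
    have hr : ∀ x : ℂ, ‖((√2 : ℝ) : ℂ)⁻¹ * x‖ ^ 4 = (‖x‖ ^ 2) ^ 2 / 4 := fun x => by
      have : √2 ^ 4 = 4 := by
        rw [show (4 : ℕ) = 2 * 2 from rfl, pow_mul, Real.sq_sqrt (by norm_num)]; norm_num
      rw [norm_mul, mul_pow, norm_inv, Complex.norm_real, Real.norm_of_nonneg (Real.sqrt_nonneg 2),
        inv_pow, this]
      ring
    rw [hr, hr, hr, hr]
    have h' : ‖φ.1 1‖ ^ 2 = 1 - ‖φ.1 0‖ ^ 2 := by linarith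
    have hz : (star (φ.1 0) * φ.1 1).re ^ 2 + (star (φ.1 0) * φ.1 1).im ^ 2 =
        ‖φ.1 0‖ ^ 2 * ‖φ.1 1‖ ^ 2 := by
      rw [← mul_pow, ← norm_star (φ.1 0), ← norm_mul, Complex.sq_norm, Complex.normSq_apply]; ring
    have e1 : (star (φ.1 0) * (Complex.I * φ.1 1)).re = -(star (φ.1 0) * φ.1 1).im := by
      rw [mul_left_comm, Complex.I_mul_re]
    have e2 : (star (φ.1 0) * (-1 * φ.1 1)).re = -(star (φ.1 0) * φ.1 1).re := by
      rw [neg_one_mul, mul_neg, Complex.neg_re]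
    have e3 : (star (φ.1 0) * (-Complex.I * φ.1 1)).re = (star (φ.1 0) * φ.1 1).im := by
      rw [neg_mul, mul_neg, Complex.neg_re, e1, neg_neg]
    simp only [norm_add_sq_eq, e1, e2, e3, norm_mul, norm_neg, Complex.norm_I, norm_one, one_mul]
    rw [h'] at hz ⊢
    linear_combination 2 * hz
  have h4 : ∫ φ, (1 + 2 * ‖φ.1 0‖ ^ 2 - 2 * ‖φ.1 0‖ ^ 4) ∂haarQubit =
      1 + 2 * ∫ φ, ‖φ.1 0‖ ^ 2 ∂haarQubit - 2 * ∫ φ, ‖φ.1 0‖ ^ 4 ∂haarQubit := by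
    rw [integral_sub (integrable_haarQubit (F := fun v => 1 + 2 * ‖v 0‖ ^ 2) (by fun_prop))
      ((integrable_haarQubit hc0).const_mul 2), integral_add (integrable_const _)
      ((integrable_haarQubit hc2).const_mul 2), integral_const_mul, integral_const_mul]
    simp
  have h5 := h3.trans ((integral_congr_ae (Eventually.of_forall e)).trans h4)
  linarith

lemma sum_norm_add_sq {ι : Type*} [Fintype ι] (x y : ι → ℂ) :
    ∑ i, ‖x i + y i‖ ^ 2 =
      ∑ i, ‖x i‖ ^ 2 + ∑ i, ‖y i‖ ^ 2 + 2 * (∑ i, star (x i) * y i).re := by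
  simp only [norm_add_sq_eq, Finset.sum_add_distrib, Complex.re_sum, Finset.mul_sum]

lemma norm_sum_star_mul_sq_le {ι : Type*} [Fintype ι] (x y : ι → ℂ) :
    ‖∑ i, star (x i) * y i‖ ^ 2 ≤ (∑ i, ‖x i‖ ^ 2) * ∑ i, ‖y i‖ ^ 2 := by
  have h1 : ‖∑ i, star (x i) * y i‖ ≤ ∑ i, ‖x i‖ * ‖y i‖ :=
    (norm_sum_le _ _).trans_eq (by simp)
  exact (pow_le_pow_left₀ (norm_nonneg _) h1 2).trans (Finset.sum_mul_sq_le_sq_mul_sq _ _ _)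

/-- The four phases cancel the terms linear in the cross term `z` and leave `|z|²`, which
Cauchy–Schwarz bounds by `p a * (q b)`. Normalisation then trades `p q` for `p²` and `q²`, so that
only the fourth moments of the amplitudes are needed. -/
lemma sum_phases_sq_le {ι : Type*} [Fintype ι] (u w : ι → ℂ) {x y : ℂ}
    (hn : ‖x‖ ^ 2 + ‖y‖ ^ 2 = 1) {a b : ℝ} (ha : a = ∑ i, ‖u i‖ ^ 2) (hb : b = ∑ i, ‖w i‖ ^ 2) :
    (∑ i, ‖u i * x + w i * y‖ ^ 2) ^ 2 + (∑ i, ‖u i * x + w i * (Complex.I * y)‖ ^ 2) ^ 2 +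
      (∑ i, ‖u i * x + w i * (-1 * y)‖ ^ 2) ^ 2 +
      (∑ i, ‖u i * x + w i * (-Complex.I * y)‖ ^ 2) ^ 2 ≤
    (4 * a ^ 2 - 8 * (a * b)) * ‖x‖ ^ 4 + (4 * b ^ 2 - 8 * (a * b)) * ‖y‖ ^ 4 + 8 * (a * b) := by
  set p := ‖x‖ ^ 2 with hp
  set q := ‖y‖ ^ 2 with hq
  set z := ∑ i, star (u i * x) * (w i * y) with hz
  have hp4 : ‖x‖ ^ 4 = p ^ 2 := by rw [hp]; ring
  have hq4 : ‖y‖ ^ 4 = q ^ 2 := by rw [hq]; ring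
  have hu : ∑ i, ‖u i * x‖ ^ 2 = p * a := by
    simp only [norm_mul, mul_pow, ← Finset.sum_mul, ← hp, ← ha]
    ring
  have hw : ∑ i, ‖w i * y‖ ^ 2 = q * b := by
    simp only [norm_mul, mul_pow, ← Finset.sum_mul, ← hq, ← hb]
    ring
  have hS : ∀ ζ : ℂ, ‖ζ‖ = 1 → ∑ i, ‖u i * x + w i * (ζ * y)‖ ^ 2 =
      p * a + q * b + 2 * (ζ * z).re := fun ζ hζ => by
    have e1 : ∀ i, ‖w i * (ζ * y)‖ = ‖w i * y‖ := fun i => by simp [hζ]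
    rw [sum_norm_add_sq, hz, Finset.mul_sum]
    simp only [e1, hu, hw]
    simp only [mul_left_comm _ ζ]
  have hS1 := hS 1 norm_one
  simp only [one_mul] at hS1
  have hzle : z.re ^ 2 + z.im ^ 2 ≤ (p * a) * (q * b) := by
    have := norm_sum_star_mul_sq_le (fun i => u i * x) (fun i => w i * y)
    rw [hu, hw, ← hz, Complex.sq_norm, Complex.normSq_apply] at this
    linarith
  have e1 : (Complex.I * z).re = -z.im := by simp
  have e2 : (-1 * z).re = -z.re := by simp
  have e3 : (-Complex.I * z).re = z.im := by simp
  rw [hS1, hS Complex.I Complex.norm_I, hS (-1) (by simp), hS (-Complex.I) (by simp), hp4, hq4, e1,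
    e2, e3]
  have hpq : p * q = (1 - p ^ 2 - q ^ 2) / 2 := by
    linear_combination (1 / 2) * (p + q + 1) * hn
  have e4 : (p * a) * (q * b) = (1 - p ^ 2 - q ^ 2) / 2 * (a * b) := by rw [← hpq]; ring
  have e5 : (p * a + q * b + 2 * z.re) ^ 2 + (p * a + q * b + 2 * -z.im) ^ 2 +
      (p * a + q * b + 2 * -z.re) ^ 2 + (p * a + q * b + 2 * z.im) ^ 2 =
      4 * (p * a) ^ 2 + 4 * (q * b) ^ 2 + 8 * ((p * a) * (q * b)) +
        8 * (z.re ^ 2 + z.im ^ 2) := by ring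
  rw [e5]
  linarith

/-- Averaging a vector-valued linear form over a Haar-random qubit. -/
lemma integral_haarQubit_sum_sq_le {ι : Type*} [Fintype ι] (u w : ι → ℂ) :
    ∫ φ, (∑ i, ‖u i * φ.1 0 + w i * φ.1 1‖ ^ 2) ^ 2 ∂haarQubit ≤
      1 / 3 * (∑ i, ‖u i‖ ^ 2 + ∑ i, ‖w i‖ ^ 2) ^ 2 := by
  obtain ⟨a, ha⟩ : ∃ a, a = ∑ i, ‖u i‖ ^ 2 := ⟨_, rfl⟩
  obtain ⟨b, hb⟩ : ∃ b, b = ∑ i, ‖w i‖ ^ 2 := ⟨_, rfl⟩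
  rw [← ha, ← hb]
  have hF : Continuous fun v : EuclideanSpace ℂ (Fin 2) =>
    (∑ i, ‖u i * v 0 + w i * v 1‖ ^ 2) ^ 2 := by fun_prop
  have h4 := integral_haarQubit_phase hF
  have hc0 : Continuous fun v : EuclideanSpace ℂ (Fin 2) => ‖v 0‖ ^ 4 := by fun_prop
  have hm0 := integral_haarQubit_norm_pow_four
  have hm1 : ∫ φ, ‖φ.1 1‖ ^ 4 ∂haarQubit = 1 / 3 :=
    (integral_haarQubit_comp swapIsometry hc0).trans hm0
  have hi0 := integrable_haarQubit hc0
  have hi1 := integrable_haarQubit (F := fun v => ‖v 1‖ ^ 4) (by fun_prop)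
  have hint : ∫ φ, ((4 * a ^ 2 - 8 * (a * b)) * ‖φ.1 0‖ ^ 4 +
      (4 * b ^ 2 - 8 * (a * b)) * ‖φ.1 1‖ ^ 4 + 8 * (a * b)) ∂haarQubit = 4 / 3 * (a + b) ^ 2 := by
    rw [integral_add ((hi0.const_mul _).fun_add (hi1.const_mul _)) (integrable_const _),
      integral_add (hi0.const_mul _) (hi1.const_mul _), integral_const_mul, integral_const_mul, hm0,
      hm1]
    simp
    ring
  have hle : ∫ φ, ((∑ i, ‖u i * φ.1 0 + w i * φ.1 1‖ ^ 2) ^ 2 +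
      (∑ i, ‖u i * φ.1 0 + w i * (Complex.I * φ.1 1)‖ ^ 2) ^ 2 +
      (∑ i, ‖u i * φ.1 0 + w i * (-1 * φ.1 1)‖ ^ 2) ^ 2 +
      (∑ i, ‖u i * φ.1 0 + w i * (-Complex.I * φ.1 1)‖ ^ 2) ^ 2) ∂haarQubit ≤
      ∫ φ, ((4 * a ^ 2 - 8 * (a * b)) * ‖φ.1 0‖ ^ 4 +
      (4 * b ^ 2 - 8 * (a * b)) * ‖φ.1 1‖ ^ 4 + 8 * (a * b)) ∂haarQubit :=
    integral_mono
      (integrable_haarQubit (F := fun v : EuclideanSpace ℂ (Fin 2) =>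
        (∑ i, ‖u i * v 0 + w i * v 1‖ ^ 2) ^ 2 +
        (∑ i, ‖u i * v 0 + w i * (Complex.I * v 1)‖ ^ 2) ^ 2 +
        (∑ i, ‖u i * v 0 + w i * (-1 * v 1)‖ ^ 2) ^ 2 +
        (∑ i, ‖u i * v 0 + w i * (-Complex.I * v 1)‖ ^ 2) ^ 2) (by fun_prop))
      (((hi0.const_mul _).fun_add (hi1.const_mul _)).fun_add (integrable_const _))
      fun φ => sum_phases_sq_le u w (normSq_add_normSq_of_mem_sphere φ) ha hb
  have h5 := h4.le.trans (hle.trans_eq hint)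
  linarith

lemma continuous_productState {N : ℕ} (s : Config N) :
    Continuous fun φ : Fin N → Metric.sphere (0 : EuclideanSpace ℂ (Fin 2)) 1 =>
      productState φ s := by
  unfold productState
  fun_prop

/-- Fourth moments of the overlap with a Haar-random product state. -/
theorem integral_haarProduct_norm_pow_four_le {N : ℕ} (v : Config N → ℂ) :
    ∫ φ, ‖∑ s, v s * productState φ s‖ ^ 4 ∂haarProduct N ≤
      (1 / 3) ^ N * (∑ s, ‖v s‖ ^ 2) ^ 2 := by
  induction N with
  | zero =>
    have h : ∀ φ, ‖∑ s, v s * productState φ s‖ ^ 4 = (∑ s, ‖v s‖ ^ 2) ^ 2 := fun φ => by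
      simp [productState, ← pow_mul]
    rw [integral_congr_ae (Eventually.of_forall h)]
    simp
  | succ N ih =>
    have hc : ∀ {M : ℕ} (v : Config M → ℂ), Continuous
        fun φ : Fin M → Metric.sphere (0 : EuclideanSpace ℂ (Fin 2)) 1 =>
          ‖∑ s, v s * productState φ s‖ ^ 4 := fun v =>
      (continuous_finsetSum _ fun s _ => (continuous_productState s).const_mul _).norm.pow 4
    -- Fixing the first qubit contracts `v` to a vector on the other qubits. The induction
    -- hypothesis brings in its squared norm, hence the one-qubit estimate for vector-valued linear
    -- forms.
    let w : Metric.sphere (0 : EuclideanSpace ℂ (Fin 2)) 1 → Config N → ℂ := fun x s =>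
      v (Fin.cons 0 s) * x.1 0 + v (Fin.cons 1 s) * x.1 1
    have hsplit : ∀ F : Config (N + 1) → ℂ, ∑ s, F s =
        ∑ s : Config N, (F (Fin.cons 0 s) + F (Fin.cons 1 s)) := fun F => by
      rw [← (splitFirst N).symm.sum_comp, Fintype.sum_prod_type, Fin.sum_univ_two,
        Finset.sum_add_distrib]
      rfl
    have hsplit' : ∀ F : Config (N + 1) → ℝ, ∑ s, F s =
        ∑ s : Config N, F (Fin.cons 0 s) + ∑ s : Config N, F (Fin.cons 1 s) := fun F => by
      rw [← (splitFirst N).symm.sum_comp, Fintype.sum_prod_type, Fin.sum_univ_two]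
      rfl
    have hcons : ∀ x φ, ∑ s, v s * productState (Fin.cons x φ) s =
        ∑ s, w x s * productState φ s := fun x φ => by
      rw [hsplit]
      refine Finset.sum_congr rfl fun s _ => ?_
      simp only [productState, Fin.prod_univ_succ, Fin.cons_zero, Fin.cons_succ, w]
      ring
    have hmp := (measurePreserving_piFinSuccAbove
      (fun _ : Fin (N + 1) => haarQubit) 0).symm
    have hsymm : ∀ q, (MeasurableEquiv.piFinSuccAbove (fun _ : Fin (N + 1) =>
        Metric.sphere (0 : EuclideanSpace ℂ (Fin 2)) 1) 0).symm q = Fin.cons q.1 q.2 := fun q => by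
      simp [MeasurableEquiv.piFinSuccAbove, Fin.insertNthEquiv]
    have h1 := hmp.integral_comp' (g := fun φ => ‖∑ s, v s * productState φ s‖ ^ 4)
    have hi : Integrable (fun q : Metric.sphere (0 : EuclideanSpace ℂ (Fin 2)) 1 ×
        (Fin N → Metric.sphere (0 : EuclideanSpace ℂ (Fin 2)) 1) =>
        ‖∑ s, v s * productState (Fin.cons q.1 q.2) s‖ ^ 4) (haarQubit.prod (haarProduct N)) := by
      refine Continuous.integrable_of_hasCompactSupport ?_ (HasCompactSupport.of_compactSpace _)
      refine (hc v).comp (continuous_pi fun i => ?_)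
      induction i using Fin.cases with
      | zero => simpa using continuous_fst
      | succ i => simpa [Function.comp_def] using (continuous_apply i).comp continuous_snd
    calc ∫ φ, ‖∑ s, v s * productState φ s‖ ^ 4 ∂haarProduct (N + 1)
        = ∫ q, ‖∑ s, v s * productState (Fin.cons q.1 q.2) s‖ ^ 4
            ∂(haarQubit.prod (haarProduct N)) := by
          rw [haarProduct, ← h1]
          simp only [hsymm]
          rfl
      _ = ∫ x, ∫ φ, ‖∑ s, w x s * productState φ s‖ ^ 4 ∂haarProduct N ∂haarQubit := by
          rw [integral_prod _ hi]
          simp only [hcons]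
      _ ≤ ∫ x, (1 / 3) ^ N * (∑ s, ‖w x s‖ ^ 2) ^ 2 ∂haarQubit := by
          refine integral_mono ?_ ?_ fun x => ih (w x)
          · have := hi.integral_prod_left
            simpa only [hcons] using this
          · exact (integrable_haarQubit (F := fun x => (∑ s : Config N,
              ‖v (Fin.cons 0 s) * x 0 + v (Fin.cons 1 s) * x 1‖ ^ 2) ^ 2) (by fun_prop)).const_mul _
      _ ≤ (1 / 3) ^ N * (1 / 3 * (∑ s, ‖v s‖ ^ 2) ^ 2) := by
          rw [integral_const_mul, hsplit']
          exact mul_le_mul_of_nonneg_left (integral_haarQubit_sum_sq_le _ _) (by positivity)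
      _ = _ := by ring

/-! ## Floquet unitaries -/

lemma star_evolveFor {N : ℕ} (τ : ℝ) {H : Operator N} (hH : H.IsHermitian) :
    star (evolveFor τ H) = evolveFor (-τ) H := by
  rw [evolveFor, evolveFor, Matrix.star_eq_conjTranspose, ← Matrix.exp_conjTranspose,
    Matrix.conjTranspose_smul, Matrix.conjTranspose_smul, hH.eq]
  simp

lemma evolveFor_mem_unitaryGroup {N : ℕ} (τ : ℝ) {H : Operator N} (hH : H.IsHermitian) :
    evolveFor τ H ∈ Matrix.unitaryGroup (Config N) ℂ := by
  rw [Matrix.mem_unitaryGroup_iff, star_evolveFor τ hH, ← evolveFor_add, add_neg_cancel,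
    evolveFor_zero]

lemma periodEvolution_mem_unitaryGroup {n N : ℕ} (T : Fin (n + 1) → ℝ) {H : Fin n → Operator N}
    (hH : ∀ j, (H j).IsHermitian) (s : ℝ) :
    periodEvolution T H s ∈ Matrix.unitaryGroup (Config N) ℂ := by
  refine Submonoid.list_prod_mem _ fun M hM => ?_
  rw [List.mem_reverse, List.mem_ofFn] at hM
  obtain ⟨j, rfl⟩ := hM
  exact evolveFor_mem_unitaryGroup _ (hH j)

lemma continuous_list_prod_reverse_ofFn {X M : Type*} [TopologicalSpace X] [TopologicalSpace M]
    [Monoid M] [ContinuousMul M] {n : ℕ} {f : Fin n → X → M} (hf : ∀ j, Continuous (f j)) :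
    Continuous fun x => (List.ofFn fun j => f j x).reverse.prod := by
  induction n with
  | zero => simpa using continuous_const
  | succ n ih =>
    simp only [List.ofFn_succ, List.reverse_cons, List.prod_append, List.prod_singleton]
    exact (ih fun j => hf j.succ).mul (hf 0)

section

attribute [local instance] Matrix.linftyOpNormedRing Matrix.linftyOpNormedAlgebra

lemma continuous_evolveFor {N : ℕ} (H : Operator N) : Continuous fun τ => evolveFor τ H :=
  continuous_iff_continuousAt.2 fun τ => (hasDerivAt_evolveFor H τ).continuousAt

end

lemma continuous_periodEvolution {n N : ℕ} (T : Fin (n + 1) → ℝ) (H : Fin n → Operator N) :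
    Continuous (periodEvolution T H) := by
  refine continuous_list_prod_reverse_ofFn fun j => (continuous_evolveFor (H j)).comp ?_
  unfold pieceTime
  fun_prop

lemma pauliAt_mul_pauliAt {N : ℕ} (l m : Fin N) (u v : Axis) (s s' : Config N) :
    (pauliAt l u * pauliAt m v) s s' = ∏ k, ((if k = l then pauli u else 1) *
      (if k = m then pauli v else 1) : Matrix (Fin 2) (Fin 2) ℂ) (s k) (s' k) := by
  simp only [Matrix.mul_apply, pauliAt, ← Finset.prod_mul_distrib]
  rw [Finset.prod_univ_sum, Fintype.piFinset_univ]

lemma pauliAt_commute {N : ℕ} {l m : Fin N} (h : l ≠ m) (u v : Axis) :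
    pauliAt l u * pauliAt m v = pauliAt m v * pauliAt l u := by
  ext s s'
  rw [pauliAt_mul_pauliAt, pauliAt_mul_pauliAt]
  refine Finset.prod_congr rfl fun k _ => ?_
  by_cases hl : k = l
  · simp [hl, h]
  · simp [hl]

lemma pieceHamiltonian_isHermitian {n N : ℕ} (α : Fin n → Axis → Fin 2)
    (γ : Fin n → Axis → Axis → Fin 2) (p : Params n N) (j : Fin n) :
    (pieceHamiltonian α γ p j).IsHermitian := by
  have hs : ∀ {A : Operator N} (r : ℝ), A.IsHermitian → ((r : ℂ) • A).IsHermitian := fun r hA => by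
    rw [Matrix.IsHermitian, Matrix.conjTranspose_smul, hA.eq]; simp
  have hsum : ∀ {ι : Type} [Fintype ι] {F : ι → Operator N}, (∀ i, (F i).IsHermitian) →
      (∑ i, F i).IsHermitian := fun hF => by
    rw [Matrix.IsHermitian, Matrix.conjTranspose_sum]
    exact Finset.sum_congr rfl fun i _ => hF i
  refine Matrix.IsHermitian.add (hsum fun l => hsum fun u => hs _ (pauliAt_isHermitian l u))
    (hsum fun l => hsum fun u => hsum fun v => hs _ ?_)
  have hne : bondRight l ≠ bondLeft l := by
    simp [bondRight, bondLeft, Fin.ext_iff]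
  rw [Matrix.IsHermitian, Matrix.conjTranspose_mul, (pauliAt_isHermitian _ _).eq,
    (pauliAt_isHermitian _ _).eq, pauliAt_commute hne]

/-! ## Dephasing -/

lemma sum_norm_sq_mulVec_of_unitary {κ : Type*} [Fintype κ] [DecidableEq κ] {S : Matrix κ κ ℂ}
    (hS : star S * S = 1) (v : κ → ℂ) : ∑ i, ‖S.mulVec v i‖ ^ 2 = ∑ i, ‖v i‖ ^ 2 := by
  have h : ∀ w : κ → ℂ, ((∑ i, ‖w i‖ ^ 2 : ℝ) : ℂ) = star w ⬝ᵥ w := fun w => by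
    simp [dotProduct, Complex.conj_mul']
  have h1 : star (S.mulVec v) ⬝ᵥ S.mulVec v = star v ⬝ᵥ v := by
    rw [Matrix.star_mulVec, ← Matrix.dotProduct_mulVec, Matrix.mulVec_mulVec,
      ← Matrix.star_eq_conjTranspose, hS, Matrix.one_mulVec]
  rw [← h, ← h] at h1
  exact_mod_cast h1

lemma sum_norm_sq_mulVec_le {N : ℕ} {A : Operator N} (hA : operatorNorm A ≤ 1) (v : Config N → ℂ) :
    ∑ i, ‖A.mulVec v i‖ ^ 2 ≤ ∑ i, ‖v i‖ ^ 2 := by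
  have h1 := (Matrix.toEuclideanCLM (𝕜 := ℂ) A).le_opNorm (WithLp.toLp 2 v)
  have h2 : ‖Matrix.toEuclideanCLM (𝕜 := ℂ) A (WithLp.toLp 2 v)‖ ≤ ‖WithLp.toLp 2 v‖ :=
    h1.trans (mul_le_of_le_one_left (norm_nonneg _) hA)
  have h3 := pow_le_pow_left₀ (norm_nonneg _) h2 2
  rw [EuclideanSpace.norm_sq_eq, EuclideanSpace.norm_sq_eq] at h3
  exact h3

lemma sum_norm_sq_col_le {N : ℕ} {A S : Operator N} (hA : operatorNorm A ≤ 1)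
    (hS : S ∈ Matrix.unitaryGroup (Config N) ℂ) (b : Config N) :
    ∑ a, ‖(star S * A * S) a b‖ ^ 2 ≤ 1 := by
  have h1 := Matrix.mem_unitaryGroup_iff.1 hS
  have h2 := Matrix.mem_unitaryGroup_iff'.1 hS
  have h3 : ∀ a, (star S * A * S) a b =
      ((star S).mulVec (A.mulVec (S.mulVec (Pi.single b 1)))) a := fun a => by
    rw [Matrix.mulVec_mulVec, Matrix.mulVec_mulVec, Matrix.mulVec_single_one]
    rfl
  simp only [h3]
  rw [sum_norm_sq_mulVec_of_unitary (by rwa [star_star])]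
  refine (sum_norm_sq_mulVec_le hA _).trans ?_
  rw [sum_norm_sq_mulVec_of_unitary h2]
  simp [Pi.single_apply, apply_ite norm]

/-- The dephasing bound `∑ |c_a|² |c_b|² |B_ab|² ≤ ∑ |c_a|⁴`. -/
lemma sum_dephasing_le {κ : Type*} [Fintype κ] {B : Matrix κ κ ℂ} (hB : B.IsHermitian)
    (hcol : ∀ b, ∑ a, ‖B a b‖ ^ 2 ≤ 1) (c : κ → ℂ) :
    ∑ a, ∑ b, ‖star (c a) * c b * B a b‖ ^ 2 ≤ ∑ a, ‖c a‖ ^ 4 := by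
  have hsymm : ∀ a b, ‖B a b‖ = ‖B b a‖ := fun a b => by
    rw [← hB.apply a b, norm_star]
  -- AM-GM decouples the weights, `|c_a|² |c_b|² ≤ (|c_a|⁴ + |c_b|⁴) / 2`; each half is then summed
  -- by a column bound.
  have h1 : ∀ a b, ‖star (c a) * c b * B a b‖ ^ 2 ≤
      1 / 2 * (‖c a‖ ^ 4 * ‖B b a‖ ^ 2) + 1 / 2 * (‖c b‖ ^ 4 * ‖B a b‖ ^ 2) := fun a b => by
    rw [norm_mul, norm_mul, norm_star, hsymm b a]
    nlinarith [mul_nonneg (sq_nonneg (‖c a‖ ^ 2 - ‖c b‖ ^ 2)) (sq_nonneg ‖B a b‖)]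
  have h2 : ∑ a, ∑ b, ‖c a‖ ^ 4 * ‖B b a‖ ^ 2 ≤ ∑ a, ‖c a‖ ^ 4 := by
    refine Finset.sum_le_sum fun a _ => ?_
    rw [← Finset.mul_sum]
    exact mul_le_of_le_one_right (by positivity) (hcol a)
  calc ∑ a, ∑ b, ‖star (c a) * c b * B a b‖ ^ 2
      ≤ ∑ a, ∑ b, (1 / 2 * (‖c a‖ ^ 4 * ‖B b a‖ ^ 2) + 1 / 2 * (‖c b‖ ^ 4 * ‖B a b‖ ^ 2)) :=
        Finset.sum_le_sum fun a _ => Finset.sum_le_sum fun b _ => h1 a b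
    _ = ∑ a, ∑ b, ‖c a‖ ^ 4 * ‖B b a‖ ^ 2 := by
        simp only [Finset.sum_add_distrib, ← Finset.mul_sum]
        rw [Finset.sum_comm (f := fun a b => ‖c b‖ ^ 4 * ‖B a b‖ ^ 2)]
        simp only [← Finset.mul_sum]
        ring
    _ ≤ _ := h2

lemma dotProduct_mulVec_eq_sum {κ : Type*} [Fintype κ] (B : Matrix κ κ ℂ) (d : κ → ℂ) :
    star d ⬝ᵥ B.mulVec d = ∑ a, ∑ b, star (d a) * d b * B a b := by
  simp only [dotProduct, Matrix.mulVec, Finset.mul_sum, Pi.star_apply]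
  exact Finset.sum_congr rfl fun a _ => Finset.sum_congr rfl fun b _ => by ring

/-- Equilibration: if the Floquet operator has nondegenerate gaps and the initial state is spread
over its eigenbasis, then expectation values are approximately periodic. -/
theorem isApproxPeriodic_expectation {n N : ℕ} {T : Fin (n + 1) → ℝ} (hT : IsTimePartition T)
    {H : Fin n → Operator N} (hH : ∀ j, (H j).IsHermitian) {O : Operator N}
    (hO : O ∈ Matrix.unitaryGroup (Config N) ℂ) {z : Config N → ℂ} (hz : ∀ a, ‖z a‖ = 1)
    (hU : periodEvolution T H 1 * O = O * Matrix.diagonal z)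
    (hgap : ∀ a b c d, z a * z b = z c * z d → s(a, b) = s(c, d))
    {A : Operator N} (hA : A.IsHermitian) (hA1 : operatorNorm A ≤ 1) (ψ : Config N → ℂ) {ε : ℝ}
    (hε : 0 < ε) (hψ : ∑ a, ‖(star O).mulVec ψ a‖ ^ 4 ≤ ε ^ 2) :
    IsApproxPeriodic ε fun t => expectation A ((evolution T H t).mulVec ψ) := by
  set c := (star O).mulVec ψ with hc
  have hOO : O * star O = 1 := Matrix.mem_unitaryGroup_iff.1 hO
  let S : ℝ → Operator N := fun x => periodEvolution T H x * O
  have hS : ∀ x, S x ∈ Matrix.unitaryGroup (Config N) ℂ := fun x =>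
    mul_mem (periodEvolution_mem_unitaryGroup T hH x) hO
  have hScont : Continuous S := (continuous_periodEvolution T H).mul continuous_const
  let B : ℝ → Operator N := fun x => star (S x) * A * S x
  have hBcont : Continuous B := (hScont.star.mul continuous_const).mul hScont
  have hBc : ∀ a b, Continuous fun x => B x a b := fun a b =>
    (continuous_apply b).comp ((continuous_apply a).comp hBcont)
  have hBH : ∀ x, (B x).IsHermitian := fun x =>
    Matrix.isHermitian_conjTranspose_mul_mul (S x) hA
  -- In the Floquet eigenbasis the period number `m` enters only through powers of eigenvalue
  -- ratios, the time `x` within a period only through `B x`.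
  have hexp : ∀ (m : ℕ) (x : ℝ), x ∈ Set.Ico (0 : ℝ) 1 →
      expectation A ((evolution T H (m + x)).mulVec ψ) =
        (∑ a, ∑ b, star (c a) * c b * B x a b * (star (z a) * z b) ^ m).re := by
    intro m x hx
    have h1 : periodEvolution T H 1 ^ m * O = O * Matrix.diagonal (fun a => z a ^ m) := by
      have h : SemiconjBy O (Matrix.diagonal z) (periodEvolution T H 1) := hU.symm
      rw [← (h.pow_right m).eq, Matrix.diagonal_pow]
      rfl
    have h2 : (evolution T H (m + x)).mulVec ψ = (S x).mulVec fun a => z a ^ m * c a := by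
      have hψc : ψ = O.mulVec c := by rw [hc, Matrix.mulVec_mulVec, hOO, Matrix.one_mulVec]
      rw [evolution_nat_add hT H m hx.1 hx.2.le, hψc, Matrix.mulVec_mulVec, mul_assoc, h1,
        ← mul_assoc, ← Matrix.mulVec_mulVec]
      congr 1
      ext a
      rw [Matrix.mulVec_diagonal]
    have h3 : ∀ d : Config N → ℂ, star ((S x).mulVec d) ⬝ᵥ A.mulVec ((S x).mulVec d) =
        star d ⬝ᵥ (B x).mulVec d := fun d => by
      rw [Matrix.star_mulVec, ← Matrix.dotProduct_mulVec, Matrix.mulVec_mulVec,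
        Matrix.mulVec_mulVec]
      simp only [B, mul_assoc]
      rfl
    rw [expectation, h2, h3, dotProduct_mulVec_eq_sum]
    congr 1
    refine Finset.sum_congr rfl fun a _ => Finset.sum_congr rfl fun b _ => ?_
    rw [star_mul', star_pow, mul_pow]
    ring
  let ι := {p : Config N × Config N // p.1 ≠ p.2}
  let ζ : ι → ℂ := fun p => star (z p.1.1) * z p.1.2
  let β : ι → ℝ → ℂ := fun p x => star (c p.1.1) * c p.1.2 * B x p.1.1 p.1.2
  have hzz : ∀ a, star (z a) * z a = 1 := fun a => by
    rw [mul_comm, RCLike.star_def, Complex.mul_conj', hz]; simp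
  -- Equal ratios give equal products `z b * z a' = z b' * z a`. The crossed matching of the labels
  -- would force `a = b`, which is why `ι` omits the diagonal.
  have hζ : Function.Injective ζ := by
    rintro ⟨⟨a, b⟩, hab⟩ ⟨⟨a', b'⟩, hab'⟩ h
    have h1 : z b * z a' = z b' * z a := by
      have h2 : star (z a) * z b * (z a * z a') = star (z a') * z b' * (z a * z a') := by
        rw [show star (z a) * z b = star (z a') * z b' from h]
      linear_combination h2 - z b * z a' * hzz a + z b' * z a * hzz a'
    have h2 := hgap _ _ _ _ h1
    simp only [ne_eq] at hab hab'
    rw [Sym2.eq_iff] at h2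
    rcases h2 with ⟨rfl, rfl⟩ | ⟨rfl, rfl⟩
    · rfl
    · exact absurd rfl hab
  have hζn : ∀ p, ‖ζ p‖ = 1 := fun p => by simp [ζ, hz]
  have hβc : ∀ p, Continuous (β p) := fun p => (hBc _ _).const_mul _
  let fbar : ℝ → ℝ := fun x => (∑ a, star (c a) * c a * B x a a).re
  have hfbar : Continuous fbar := Complex.continuous_re.comp
    (continuous_finsetSum _ fun a _ => (hBc a a).const_mul _)
  let g : ℕ → ℝ → ℂ := fun m x => ∑ p, β p x * ζ p ^ m
  have hgc : ∀ m, Continuous (g m) := fun m =>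
    continuous_finsetSum _ fun p _ => (hβc p).mul_const _
  have hdiff : ∀ (m : ℕ) (x : ℝ), x ∈ Set.Ico (0 : ℝ) 1 →
      expectation A ((evolution T H (m + x)).mulVec ψ) - fbar x = (g m x).re := by
    intro m x hx
    rw [hexp m x hx, ← Complex.sub_re]
    congr 1
    rw [sub_eq_iff_eq_add]
    have h1 := Fintype.sum_subtype_add_sum_subtype (fun p : Config N × Config N => p.1 ≠ p.2)
      fun p => star (c p.1) * c p.2 * B x p.1 p.2 * (star (z p.1) * z p.2) ^ m
    rw [← Fintype.sum_prod_type' (f := fun a b => star (c a) * c b * B x a b *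
      (star (z a) * z b) ^ m), ← h1]
    congr 1
    symm
    refine Fintype.sum_bijective (fun a => (⟨(a, a), by simp⟩ :
      {p : Config N × Config N // ¬ p.1 ≠ p.2})) ⟨fun a b h => ?_, ?_⟩ _ _ fun a => ?_
    · exact congrArg (fun p : {p : Config N × Config N // ¬ p.1 ≠ p.2} => p.1.1) h
    · rintro ⟨⟨a, b⟩, hab⟩
      obtain rfl : a = b := not_not.1 hab
      exact ⟨a, rfl⟩
    · simp only [hzz, one_pow, mul_one]
  have hlim := tendsto_average_integral_norm_sq hζ hζn hβc
  have hint : ∀ {F : ℝ → ℝ}, Continuous F → IntegrableOn F (Set.Ico 0 1) := fun hF =>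
    (hF.integrableOn_Icc (a := 0) (b := 1)).mono_set Set.Ico_subset_Icc_self
  refine ⟨fbar, hfbar.measurable, one_sub_le_liminf_density (fun m => integral_nonneg fun x => ?_)
    hε ?_ hlim fun m hm => ?_⟩
  · positivity
  · have hβ2 : ∀ p, IntegrableOn (fun x => ‖β p x‖ ^ 2) (Set.Ico 0 1) := fun p =>
      hint (((hβc p).norm).pow 2)
    rw [← integral_finsetSum _ fun p _ => hβ2 p]
    calc ∫ x in Set.Ico (0 : ℝ) 1, ∑ p, ‖β p x‖ ^ 2
        ≤ ∫ x in Set.Ico (0 : ℝ) 1, ∑ a, ‖c a‖ ^ 4 := by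
          refine integral_mono (hint (continuous_finsetSum _ fun p _ => ((hβc p).norm).pow 2))
            (hint continuous_const) fun x => ?_
          -- The dephasing bound covers all pairs; the nonnegative diagonal terms are added back.
          refine le_trans ?_ (sum_dephasing_le (hBH x) (sum_norm_sq_col_le hA1 (hS x)) c)
          rw [← Fintype.sum_prod_type' (f := fun a b => ‖star (c a) * c b * B x a b‖ ^ 2),
            ← Fintype.sum_subtype_add_sum_subtype (fun p : Config N × Config N => p.1 ≠ p.2)]
          exact le_add_of_nonneg_right (Finset.sum_nonneg fun p _ => by positivity)
      _ = ∑ a, ‖c a‖ ^ 4 := by simp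
      _ ≤ ε ^ 2 := hψ
  · have hcongr : Set.EqOn
        (fun x : ℝ => |expectation A ((evolution T H (m + x)).mulVec ψ) - fbar x| ^ 2)
        (fun x => |(g m x).re| ^ 2) (Set.Ico 0 1) := fun x hx => by
      simp only [hdiff m x hx]
    have hi : IntegrableOn (fun x => |(g m x).re| ^ 2) (Set.Ico 0 1) :=
      hint (((Complex.continuous_re.comp (hgc m)).abs).pow 2)
    refine ⟨(integrableOn_congr_fun hcongr measurableSet_Ico).2 hi, ?_⟩
    rw [setIntegral_congr_fun measurableSet_Ico hcongr]
    refine le_trans (integral_mono hi (hint ((hgc m).norm.pow 2)) fun x => ?_) hm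
    exact pow_le_pow_left₀ (abs_nonneg _) (Complex.abs_re_le_norm _) 2

/-! ## Genericity of nondegenerate gaps -/

section

attribute [local instance] Matrix.linftyOpNormedRing Matrix.linftyOpNormedAlgebra

lemma AnalyticAt.list_prod_reverse_ofFn {E M : Type*} [NormedAddCommGroup E] [NormedSpace ℝ E]
    [NormedRing M] [NormedAlgebra ℝ M] {n : ℕ} {f : Fin n → E → M} {p : E}
    (hf : ∀ j, AnalyticAt ℝ (f j) p) :
    AnalyticAt ℝ (fun x => (List.ofFn fun j => f j x).reverse.prod) p := by
  induction n with
  | zero => simpa using analyticAt_const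
  | succ n ih =>
    simp only [List.ofFn_succ, List.reverse_cons, List.prod_append, List.prod_singleton]
    exact (ih fun j => hf j.succ).mul (hf 0)

lemma analyticAt_pieceHamiltonian {n N : ℕ} (α : Fin n → Axis → Fin 2)
    (γ : Fin n → Axis → Axis → Fin 2) (j : Fin n) (p : Params n N) :
    AnalyticAt ℝ (fun p => pieceHamiltonian α γ p j) p := by
  have h : ∀ {E : Type} [NormedAddCommGroup E] [NormedSpace ℝ E] (φ : E →L[ℝ] ℝ) (k : ℝ) (x : E)
      (M : Operator N), AnalyticAt ℝ (fun x => ((k * φ x : ℝ) : ℂ) • M) x := fun φ k x M =>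
    ((Complex.ofRealCLM.comp (k • φ)).smulRight M).analyticAt x
  refine AnalyticAt.add ?_ ?_
  · refine Finset.analyticAt_fun_sum _ fun l _ => Finset.analyticAt_fun_sum _ fun u _ => ?_
    exact h ((ContinuousLinearMap.proj (j, l, u)).comp (ContinuousLinearMap.fst ℝ _ _)) _ p _
  · refine Finset.analyticAt_fun_sum _ fun l _ => Finset.analyticAt_fun_sum _ fun u _ =>
      Finset.analyticAt_fun_sum _ fun v _ => ?_
    exact h ((ContinuousLinearMap.proj (j, l, u, v)).comp (ContinuousLinearMap.snd ℝ _ _)) _ p _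

lemma analyticAt_periodEvolution {n N : ℕ} (T : Fin (n + 1) → ℝ) (α : Fin n → Axis → Fin 2)
    (γ : Fin n → Axis → Axis → Fin 2) (s : ℝ) (p : Params n N) :
    AnalyticAt ℝ (fun p => periodEvolution T (pieceHamiltonian α γ p) s) p := by
  refine AnalyticAt.list_prod_reverse_ofFn fun j => ?_
  let L : Operator N →ₗ[ℝ] Operator N :=
    pieceTime T j s • ((-Complex.I • LinearMap.id : Operator N →ₗ[ℂ] Operator N).restrictScalars ℝ)
  have h1 : AnalyticAt ℝ (fun p => pieceTime T j s • (-Complex.I • pieceHamiltonian α γ p j)) p :=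
    (L.toContinuousLinearMap.analyticAt _).comp (analyticAt_pieceHamiltonian α γ j p)
  exact (NormedSpace.exp_analytic (𝕂 := ℝ) _).comp h1

/-- Traces of powers avoid any choice of eigenvalues, which need not be analytic where they cross.
-/
lemma analyticAt_gapDiscriminant {κ : Type*} [Fintype κ] [DecidableEq κ] (U : Matrix κ κ ℂ) :
    AnalyticAt ℝ (gapDiscriminant : Matrix κ κ ℂ → ℂ) U := by
  have htr : ∀ m : ℕ, AnalyticAt ℝ (fun U : Matrix κ κ ℂ => (U ^ m).trace) U := fun m =>
    ((Matrix.traceLinearMap κ ℝ ℂ).toContinuousLinearMap.analyticAt _).comp (analyticAt_id.pow m)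
  unfold gapDiscriminant
  simp only [Matrix.det_apply]
  refine Finset.analyticAt_fun_sum _ fun σ _ => ?_
  have : ∀ x : ℂ, Equiv.Perm.sign σ • x = ((Equiv.Perm.sign σ : ℤ) : ℂ) * x := fun x => by
    rw [Units.smul_def, zsmul_eq_mul]
  simp only [this]
  refine analyticAt_const.mul (Finset.analyticAt_fun_prod _ fun i _ => ?_)
  simp only [Matrix.of_apply]
  exact (((htr _).pow 2).add (htr _)).div_const

lemma ae_gapDiscriminant_ne_zero {n N : ℕ} (T : Fin (n + 1) → ℝ) (α : Fin n → Axis → Fin 2)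
    (γ : Fin n → Axis → Axis → Fin 2) {p₀ : Params n N}
    (h : gapDiscriminant (periodEvolution T (pieceHamiltonian α γ p₀) 1) ≠ 0) :
    ∀ᵐ p : Params n N, gapDiscriminant (periodEvolution T (pieceHamiltonian α γ p) 1) ≠ 0 :=
  haveI : (volume : Measure (Params n N)).IsAddHaarMeasure := by
    have := isAddHaarMeasure_volume_pi (Fin n × Fin N × Axis)
    have := isAddHaarMeasure_volume_pi (Fin n × Fin (N - 1) × Axis × Axis)
    exact Measure.prod.instIsAddHaarMeasure volume volume
  AnalyticOnNhd.ae_ne_zero volume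
    (f := fun p : Params n N => gapDiscriminant (periodEvolution T (pieceHamiltonian α γ p) 1))
    (fun p _ => (analyticAt_gapDiscriminant _).comp (analyticAt_periodEvolution T α γ 1 p)) h

end

/-! ### A parameter point with nondegenerate gaps -/

lemma evolveFor_mul_of_diagonalization {N : ℕ} {H O : Operator N}
    (hO : O ∈ Matrix.unitaryGroup (Config N) ℂ) {E : Config N → ℝ}
    (h : H * O = O * Matrix.diagonal fun a => (E a : ℂ)) (τ : ℝ) :
    evolveFor τ H * O = O * Matrix.diagonal fun a => Complex.exp (-Complex.I * (τ * E a)) := by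
  have h1 := Matrix.mem_unitaryGroup_iff.1 hO
  have h2 := Matrix.mem_unitaryGroup_iff'.1 hO
  have hinv : O⁻¹ = star O := Matrix.inv_eq_left_inv h2
  have hH : τ • (-Complex.I • H) =
      O * Matrix.diagonal (fun a => -Complex.I * (τ * E a)) * O⁻¹ := by
    have h3 : H = O * Matrix.diagonal (fun a => (E a : ℂ)) * star O := by
      rw [← h, mul_assoc, h1, mul_one]
    have h4 : Matrix.diagonal (fun a => -Complex.I * (τ * E a)) =
        τ • (-Complex.I • Matrix.diagonal fun a => (E a : ℂ)) := by
      ext a b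
      by_cases hab : a = b
      · subst hab
        simp
        ring
      · simp [hab]
    rw [h4, mul_smul_comm, mul_smul_comm, smul_mul_assoc, smul_mul_assoc, hinv, ← h3]
  rw [evolveFor, hH, Matrix.exp_conj _ _ ⟨⟨O, star O, h1, h2⟩, rfl⟩, hinv, mul_assoc, h2,
    mul_one, Matrix.exp_diagonal]
  congr 2
  ext a
  rw [Pi.coe_exp, Complex.exp_eq_exp_ℂ]

/-- There are parameters for which the Floquet operator has nondegenerate gaps. -/
lemma exists_gapDiscriminant_ne_zero {n N : ℕ} (hN : 0 < N) (hn : 0 < n) {T : Fin (n + 1) → ℝ}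
    (hT : IsTimePartition T) (α : Fin n → Axis → Fin 2) (γ : Fin n → Axis → Axis → Fin 2)
    (hx : α ⟨0, hn⟩ Axis.x = 1) (hz : α ⟨0, hn⟩ Axis.z = 1) (hzz : γ ⟨0, hn⟩ Axis.z Axis.z = 1) :
    ∃ p : Params n N, gapDiscriminant (periodEvolution T (pieceHamiltonian α γ p) 1) ≠ 0 := by
  obtain ⟨N, rfl⟩ : ∃ M, N = M + 1 := ⟨N - 1, by omega⟩
  obtain ⟨f, g, J, O, hO, E, hE, hgap, -⟩ := exists_isGenericPair_isingChain N
  set j₀ : Fin n := ⟨0, hn⟩ with hj₀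
  set t₁ := T j₀.succ with ht₁
  have hT0 : T j₀.castSucc = 0 := by rw [← hT.1]; rfl
  have ht₁0 : 0 < t₁ := by rw [← hT0]; exact hT.2.1 (Fin.castSucc_lt_succ)
  have ht₁1 : t₁ ≤ 1 := hT.2.2 ▸ hT.2.1.monotone (Fin.le_last _)
  set R := ∑ a, |E a| with hR
  have hER : ∀ a, |E a| ≤ R := fun a =>
    Finset.single_le_sum (f := fun a => |E a|) (fun _ _ => abs_nonneg _) (Finset.mem_univ a)
  have hR0 : 0 ≤ R := Finset.sum_nonneg fun _ _ => abs_nonneg _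
  -- Differences of two energy sums are at most `4R`, so the phases over the time `θ` differ by less
  -- than `1 < 2π`: equal phase factors force equal energy sums.
  set θ := 1 / (4 * R + 1) with hθ
  have hθ0 : 0 < θ := by positivity
  set δ := θ / t₁ with hδ
  -- All pieces except the first are switched off; scaling the first by `δ = θ / t₁` makes the whole
  -- period equal to evolution under the Ising chain for time `θ`.
  let p : Params n (N + 1) :=
    (fun i => if i.1 = j₀ then (match i.2.2 with
      | .x => δ * f i.2.1
      | .y => 0
      | .z => δ * g i.2.1) else 0,
    fun i => if i.1 = j₀ ∧ i.2.2.1 = .z ∧ i.2.2.2 = .z then δ * J i.2.1 else 0)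
  have huniv : (Finset.univ : Finset Axis) = {Axis.x, Axis.y, Axis.z} := rfl
  have hp0 : pieceHamiltonian α γ p j₀ = (δ : ℂ) • isingChain f g J := by
    rw [pieceHamiltonian, isingChain, smul_add, smul_add, Finset.smul_sum, Finset.smul_sum,
      Finset.smul_sum, ← Finset.sum_add_distrib]
    congr 1
    · refine Finset.sum_congr rfl fun l _ => ?_
      rw [huniv, Finset.sum_insert (by decide), Finset.sum_insert (by decide),
        Finset.sum_singleton]
      simp [p, hx, hz, smul_smul, -Complex.coe_smul]
    · refine Finset.sum_congr rfl fun l _ => ?_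
      rw [Finset.sum_eq_single Axis.z, Finset.sum_eq_single Axis.z]
      · simp [p, hzz, smul_smul, -Complex.coe_smul]
      · intro v _ hv
        simp [p, hv]
      · simp
      · intro u _ hu
        simp [p, hu]
      · simp
  have hpj : ∀ j, j ≠ j₀ → pieceHamiltonian α γ p j = 0 := fun j hj => by
    simp [pieceHamiltonian, p, hj]
  have hev0 : ∀ τ, evolveFor τ (0 : Operator (N + 1)) = 1 := fun τ => by simp [evolveFor]
  have hper : periodEvolution T (pieceHamiltonian α γ p) 1 = evolveFor θ (isingChain f g J) := by
    have h := prod_reverse_ofFn_of_step (fun _ : Fin n => (1 : Operator (N + 1)))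
      (fun j => evolveFor (pieceTime T j 1) (pieceHamiltonian α γ p j))
      (evolveFor θ (isingChain f g J)) j₀
      (fun i hi => by rw [hpj i hi.ne, hev0]) ?_ (fun i hi => ⟨by rw [hpj i hi.ne', hev0], rfl⟩)
    · rw [periodEvolution, h]
      simp
    · have h1 : pieceTime T j₀ 1 = t₁ := by
        rw [pieceTime, min_eq_right ht₁1, hT0, sub_zero, max_eq_right ht₁0.le]
      rw [h1, hp0, mul_one, evolveFor, evolveFor, smul_comm (-Complex.I) (δ : ℂ),
        Complex.coe_smul, smul_smul, hδ, mul_div_cancel₀ _ ht₁0.ne']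
  refine ⟨p, ?_⟩
  rw [hper, gapDiscriminant_ne_zero_iff hO (evolveFor_mul_of_diagonalization hO hE θ)]
  intro a b c d h
  refine hgap a b c d ?_
  rw [← Complex.exp_add, ← Complex.exp_add, Complex.exp_eq_exp_iff_exists_int] at h
  obtain ⟨k, hk⟩ := h
  have h1 : θ * (E c + E d - (E a + E b)) = k * (2 * Real.pi) := by
    have := congrArg Complex.im hk
    simp at this
    linarith
  have ha := abs_le.1 (hER a)
  have hb := abs_le.1 (hER b)
  have hc := abs_le.1 (hER c)
  have hd := abs_le.1 (hER d)
  have h2 : |θ * (E c + E d - (E a + E b))| < 1 := by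
    rw [abs_mul, abs_of_pos hθ0, hθ, one_div, inv_mul_lt_iff₀ (by positivity), mul_one, abs_lt]
    constructor <;> linarith
  have hk0 : k = 0 := by
    by_contra hk0
    have h3 : (1 : ℝ) ≤ |(k : ℝ)| := by exact_mod_cast Int.one_le_abs hk0
    rw [h1, abs_mul, abs_of_pos (by positivity : (0 : ℝ) < 2 * Real.pi)] at h2
    nlinarith [Real.pi_gt_three]
  rw [hk0, Int.cast_zero, zero_mul] at h1
  have := (mul_eq_zero.1 h1).resolve_left hθ0.ne'
  linarith

/-! ### Averaged inverse participation ratio and conclusion -/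

/-- The average over Haar-random product states of the inverse participation ratio in a given
orthonormal basis decays exponentially in the number of qubits. -/
lemma integral_sum_norm_mulVec_productState_pow_four_le {N : ℕ} {O : Operator N}
    (hO : O ∈ Matrix.unitaryGroup (Config N) ℂ) :
    ∫ φ, ∑ a, ‖(star O).mulVec (productState φ) a‖ ^ 4 ∂haarProduct N ≤ (2 / 3) ^ N := by
  have hrow : ∀ a, ∑ s, ‖star O a s‖ ^ 2 = 1 := fun a => by
    have h := congrFun (congrFun (Matrix.mem_unitaryGroup_iff'.1 hO) a) a
    rw [Matrix.mul_apply, Matrix.one_apply_eq] at h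
    have h' : ((∑ s, ‖star O a s‖ ^ 2 : ℝ) : ℂ) = 1 := by
      rw [← h]
      push_cast
      refine Finset.sum_congr rfl fun s _ => ?_
      rw [← Complex.mul_conj', Matrix.star_apply, ← Complex.star_def, star_star]
    exact_mod_cast h'
  rw [integral_finsetSum]
  · refine (Finset.sum_le_sum fun a _ =>
      integral_haarProduct_norm_pow_four_le (N := N) (star O a)).trans_eq ?_
    simp only [hrow, one_pow, mul_one, Finset.sum_const, Finset.card_univ, Fintype.card_fun,
      Fintype.card_fin, nsmul_eq_mul, Nat.cast_pow, Nat.cast_ofNat]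
    rw [← mul_pow]
    norm_num
  · intro a _
    refine Continuous.integrable_of_hasCompactSupport ?_ (HasCompactSupport.of_compactSpace _)
    have := continuous_productState (N := N)
    simp only [Matrix.mulVec, dotProduct]
    fun_prop

theorem theorem2 :
    ∃ c : ℝ, 0 < c ∧ ∃ N₀ : ℕ, ∀ N : ℕ, N₀ < N →
      ∀ (n : ℕ) (hn : 0 < n) (T : Fin (n + 1) → ℝ), IsTimePartition T →
      ∀ (α : Fin n → Axis → Fin 2) (γ : Fin n → Axis → Axis → Fin 2),
        α ⟨0, hn⟩ Axis.x = 1 → α ⟨0, hn⟩ Axis.z = 1 → γ ⟨0, hn⟩ Axis.z Axis.z = 1 →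
      ∀ᵐ p : Params n N, ∀ A : Operator N, A.IsHermitian → operatorNorm A = 1 →
        haarProduct N {φ | ¬ IsApproxPeriodic (Real.exp (-(c * N))) (fun t =>
            expectation A
              ((evolution T (pieceHamiltonian α γ p) t).mulVec (productState φ)))} ≤
          ENNReal.ofReal (Real.exp (-(c * N))) := by
  -- This `c` gives `ε = exp(-cN)` with `ε³ = (2/3)^N`. Markov's inequality at the threshold `ε²`
  -- required for equilibration then leaves probability at most `ε³ / ε² = ε`. Every `N ≥ 1` is
  -- allowed.
  refine ⟨Real.log (3 / 2) / 3, by have := Real.log_pos (by norm_num : (1 : ℝ) < 3 / 2); positivity,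
    0, fun N hN n hn T hT α γ hx hz hzz => ?_⟩
  obtain ⟨p₀, hp₀⟩ := exists_gapDiscriminant_ne_zero hN hn hT α γ hx hz hzz
  filter_upwards [ae_gapDiscriminant_ne_zero T α γ hp₀] with p hp A hA hA1
  set ε := Real.exp (-(Real.log (3 / 2) / 3 * N)) with hε
  have hε0 : 0 < ε := Real.exp_pos _
  have hε3 : ε ^ 3 = (2 / 3) ^ N := by
    rw [hε, ← Real.exp_nat_mul, show ((3 : ℕ) : ℝ) * -(Real.log (3 / 2) / 3 * N) =
      N * -Real.log (3 / 2) by push_cast; ring, Real.exp_nat_mul, Real.exp_neg,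
      Real.exp_log (by norm_num)]
    norm_num
  have hH := fun j => pieceHamiltonian_isHermitian α γ p j
  obtain ⟨O, hO, z, hz, hU⟩ :=
    exists_unitary_diagonalization (periodEvolution_mem_unitaryGroup T hH 1)
  have hgap := (gapDiscriminant_ne_zero_iff hO hU).1 hp
  -- The exceptional set of states is controlled by `D` alone, which depends on the Floquet
  -- eigenbasis but not on `A`.
  set D : (Fin N → Metric.sphere (0 : EuclideanSpace ℂ (Fin 2)) 1) → ℝ :=
    fun φ => ∑ a, ‖(star O).mulVec (productState φ) a‖ ^ 4 with hD
  have hDint : Integrable D (haarProduct N) := by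
    refine Continuous.integrable_of_hasCompactSupport ?_ (HasCompactSupport.of_compactSpace _)
    have := continuous_productState (N := N)
    simp only [hD, Matrix.mulVec, dotProduct]
    fun_prop
  have hD0 : 0 ≤ D := fun φ => Finset.sum_nonneg fun _ _ => by positivity
  have hmarkov := mul_meas_ge_le_integral_of_nonneg (ae_of_all _ hD0) hDint (ε ^ 2)
  have hle : (haarProduct N).real {φ | ε ^ 2 ≤ D φ} ≤ ε := by
    have h := hmarkov.trans (integral_sum_norm_mulVec_productState_pow_four_le hO)
    rw [← hε3, pow_succ ε 2] at h
    exact le_of_mul_le_mul_left h (by positivity)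
  refine (measure_mono fun φ hφ => ?_).trans
    ((ofReal_measureReal (μ := haarProduct N) (s := {φ | ε ^ 2 ≤ D φ})).symm.trans_le
      (ENNReal.ofReal_le_ofReal hle))
  by_contra hlt
  exact hφ (isApproxPeriodic_expectation hT hH hO hz hU hgap hA hA1.le (productState φ) hε0
    (not_le.1 hlt).le)
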